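/- Let $G$ be a (discrete) group that is amenable, finitely generated and residually finite, and let $$0\longrightarrow (J,\alpha)\xrightarrow{\ \iota\ }(A,\beta)\xrightarrow{\ \pi\ }(B,\gamma)\longrightarrow 0$$ be a short exact sequence of $G$-algebras; that is, $J,A,B$ are C*-algebras (not necessarily unital or separable) with actions $\alpha,\beta,\gamma$ of $G$ by $*$-automorphisms, and $\iota,\pi$ are $G$-equivariant $*$-homomorphisms with $\iota$ injective, $\pi$ surjective and $\iota(J)=\ker\pi$. Then $$\dim_{Rok}(\beta)\le \dim_{Rok}(\alpha)+\dim_{Rok}(\gamma)+1\quad\text{and}\quad \dim_{Rok}^c(\beta)\le \dim_{Rok}^c(\alpha)+\dim_{Rok}^c(\gamma)+1$$ in $\{0,1,2,\dots,\infty\}$. Here the Rokhlin dimensions of an action $\alpha$ of $G$ on a C*-algebra $A$ are defined as follows. Let $A_\infty=\ell^\infty(\mathbb N,A)/c_0(\mathbb N,A)$, with $A\subset A_\infty$ as constant sequences. For a separable $\alpha$-invariant C*-subalgebra $D\subset A$ put $F(D,A)=(A_\infty\cap D')/\{x\in A_\infty\cap D' : xd=dx=0 \text{ for all } d\in D\}$,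 a unital C*-algebra with the $G$-action $\widetilde\alpha_\infty$ induced by $\alpha$. For a subgroup $H\le G$ of finite index let $\sigma^H$ be the left-translation action of $G$ on $C(G/H)$. Then $\dim_{Rok}(\alpha,H)$ is the least integer $d\ge 0$ such that for every separable $\alpha$-invariant C*-subalgebra $D\subset A$ there are $d+1$ equivariant, contractive, completely positive maps $\varphi_0,\dots,\varphi_d:(C(G/H),\sigma^H)\to (F(D,A),\widetilde\alpha_\infty)$ of order zero (i.e. preserving orthogonality, where $a\perp b$ means $ab=ba=a^*b=b^*a=0$) with $\sum_{l=0}^d\varphi_l(1)=1_{F(D,A)}$, and $\infty$ if there is no such $d$. The number $\dim_{Rok}^c(\alpha,H)$ is defined in the same way, requiring in addition that $\varphi_0,\dots,\varphi_d$ have pairwise commuting ranges. Finally $\dim_{Rok}(\alpha)=\sup_H\dim_{Rok}(\alpha,H)$ and $\dim_{Rok}^c(\alpha)=\sup_H\dim_{Rok}^c(\alpha,H)$, the suprema being over all subgroups $H\le G$ of finite index. -/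

import Mathlib

open Filter Topology
open scoped ENNReal ComplexOrder

noncomputable section

namespace RokhlinDim

universe u v

/-! ### Quotients of C*-algebras by closed two-sided ideals -/

/-- A closed, two-sided, self-adjoint ideal of a C*-algebra. -/
structure ClosedIdeal (A : Type u) [NonUnitalCStarAlgebra A] extends Submodule ℂ A where
  mul_mem_left' : ∀ a x : A, x ∈ carrier → a * x ∈ carrier
  mul_mem_right' : ∀ a x : A, x ∈ carrier → x * a ∈ carrier
  star_mem' : ∀ x : A, x ∈ carrier → star x ∈ carrier
  isClosed' : IsClosed carrier

namespace ClosedIdeal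

variable {A : Type u} [NonUnitalCStarAlgebra A]

instance : SetLike (ClosedIdeal A) A where
  coe I := I.carrier
  coe_injective I J h := by
    obtain ⟨I, _, _, _, _⟩ := I
    obtain ⟨J, _, _, _, _⟩ := J
    have : I = J := SetLike.coe_injective h
    subst this
    rfl

instance : AddSubgroupClass (ClosedIdeal A) A where
  add_mem {I} _ _ ha hb := I.toSubmodule.add_mem ha hb
  zero_mem I := I.toSubmodule.zero_mem
  neg_mem {I} _ ha := I.toSubmodule.neg_mem ha

instance : NonUnitalSubringClass (ClosedIdeal A) A where
  mul_mem {I} _ _ _ hb := I.mul_mem_left' _ _ hb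

instance : SMulMemClass (ClosedIdeal A) ℂ A where
  smul_mem {I} c _ ha := I.toSubmodule.smul_mem c ha

instance : StarMemClass (ClosedIdeal A) A where
  star_mem {I} _ ha := I.star_mem' _ ha

variable (I : ClosedIdeal A)

theorem mul_mem_left (a : A) {x : A} (hx : x ∈ I) : a * x ∈ I := I.mul_mem_left' a x hx

theorem mul_mem_right (a : A) {x : A} (hx : x ∈ I) : x * a ∈ I := I.mul_mem_right' a x hx

instance : IsClosed (I : Set A) := I.isClosed'

instance : IsClosed (I.toSubmodule : Set A) := I.isClosed'

/-- The quotient C*-algebra `A / I`, with the quotient norm. -/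
def Quotient : Type u := A ⧸ I.toSubmodule

namespace Quotient

instance : NormedAddCommGroup I.Quotient :=
  inferInstanceAs (NormedAddCommGroup (A ⧸ I.toSubmodule))

instance : NormedSpace ℂ I.Quotient :=
  inferInstanceAs (NormedSpace ℂ (A ⧸ I.toSubmodule))

instance : CompleteSpace I.Quotient :=
  inferInstanceAs (CompleteSpace (A ⧸ I.toSubmodule))

/-- The quotient map, as a linear map. -/
def mkₗ : A →ₗ[ℂ] I.Quotient := I.toSubmodule.mkQ

variable {I}

theorem mkₗ_surjective : Function.Surjective (mkₗ I) := Submodule.mkQ_surjective _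

theorem mkₗ_eq_iff {x y : A} : mkₗ I x = mkₗ I y ↔ x - y ∈ I :=
  Submodule.Quotient.eq I.toSubmodule

theorem norm_mkₗ_le (x : A) : ‖mkₗ I x‖ ≤ ‖x‖ :=
  Submodule.Quotient.norm_mk_le (S := I.toSubmodule) x

theorem exists_norm_lt (x : I.Quotient) {ε : ℝ} (hε : 0 < ε) :
    ∃ a : A, mkₗ I a = x ∧ ‖a‖ < ‖x‖ + ε :=
  Submodule.Quotient.norm_mk_lt (S := I.toSubmodule) x hε

instance : Mul I.Quotient where
  mul := Quotient.map₂ (· * ·) (by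
    intro a b hab c d hcd
    have hab' : a - b ∈ I := (Submodule.quotientRel_def I.toSubmodule).1 hab
    have hcd' : c - d ∈ I := (Submodule.quotientRel_def I.toSubmodule).1 hcd
    refine (Submodule.quotientRel_def I.toSubmodule).2 ?_
    have h : a * c - b * d = (a - b) * c + b * (c - d) := by
      rw [sub_mul, mul_sub]; abel
    change a * c - b * d ∈ I
    rw [h]
    exact add_mem (I.mul_mem_right _ hab') (I.mul_mem_left _ hcd'))

instance : Star I.Quotient where
  star := Quotient.map star (by
    intro a b hab
    have hab' : a - b ∈ I := (Submodule.quotientRel_def I.toSubmodule).1 hab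
    refine (Submodule.quotientRel_def I.toSubmodule).2 ?_
    change star a - star b ∈ I
    rw [← star_sub]
    exact star_mem hab')

theorem mkₗ_mul (x y : A) : mkₗ I (x * y) = mkₗ I x * mkₗ I y := rfl

theorem mkₗ_star (x : A) : mkₗ I (star x) = star (mkₗ I x) := rfl

instance : NonUnitalRing I.Quotient where
  left_distrib a b c := by
    obtain ⟨a, rfl⟩ := mkₗ_surjective a
    obtain ⟨b, rfl⟩ := mkₗ_surjective b
    obtain ⟨c, rfl⟩ := mkₗ_surjective c
    simp only [← map_add, ← mkₗ_mul, mul_add]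
  right_distrib a b c := by
    obtain ⟨a, rfl⟩ := mkₗ_surjective a
    obtain ⟨b, rfl⟩ := mkₗ_surjective b
    obtain ⟨c, rfl⟩ := mkₗ_surjective c
    simp only [← map_add, ← mkₗ_mul, add_mul]
  zero_mul a := by
    obtain ⟨a, rfl⟩ := mkₗ_surjective a
    rw [← map_zero (mkₗ I), ← mkₗ_mul, zero_mul]
  mul_zero a := by
    obtain ⟨a, rfl⟩ := mkₗ_surjective a
    rw [← map_zero (mkₗ I), ← mkₗ_mul, mul_zero]
  mul_assoc a b c := by
    obtain ⟨a, rfl⟩ := mkₗ_surjective a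
    obtain ⟨b, rfl⟩ := mkₗ_surjective b
    obtain ⟨c, rfl⟩ := mkₗ_surjective c
    simp only [← mkₗ_mul, mul_assoc]

instance : NonUnitalNormedRing I.Quotient where
  dist_eq := dist_eq_norm_neg_add
  norm_mul_le x y := by
    refine le_of_forall_pos_lt_add fun ε hε => ?_
    have hc : Tendsto (fun δ : ℝ => (‖x‖ + δ) * (‖y‖ + δ)) (𝓝[>] 0) (𝓝 (‖x‖ * ‖y‖)) := by
      have : Continuous fun δ : ℝ => (‖x‖ + δ) * (‖y‖ + δ) := by fun_prop
      have := (this.tendsto 0).mono_left (nhdsWithin_le_nhds (s := Set.Ioi 0))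
      simpa using this
    have h1 := hc.eventually (gt_mem_nhds (lt_add_of_pos_right (‖x‖ * ‖y‖) hε))
    obtain ⟨δ, hδ, hδ0⟩ := (h1.and self_mem_nhdsWithin).exists
    obtain ⟨a, rfl, ha⟩ := exists_norm_lt x hδ0
    obtain ⟨b, rfl, hb⟩ := exists_norm_lt y hδ0
    calc ‖mkₗ I a * mkₗ I b‖ = ‖mkₗ I (a * b)‖ := rfl
      _ ≤ ‖a * b‖ := norm_mkₗ_le _
      _ ≤ ‖a‖ * ‖b‖ := norm_mul_le _ _
      _ ≤ (‖mkₗ I a‖ + δ) * (‖mkₗ I b‖ + δ) := by gcongr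
      _ < _ := hδ

instance : StarRing I.Quotient where
  star_involutive a := by
    obtain ⟨a, rfl⟩ := mkₗ_surjective a
    rw [← mkₗ_star, ← mkₗ_star, star_star]
  star_mul a b := by
    obtain ⟨a, rfl⟩ := mkₗ_surjective a
    obtain ⟨b, rfl⟩ := mkₗ_surjective b
    simp only [← mkₗ_star, ← mkₗ_mul, star_mul]
  star_add a b := by
    obtain ⟨a, rfl⟩ := mkₗ_surjective a
    obtain ⟨b, rfl⟩ := mkₗ_surjective b
    simp only [← map_add, ← mkₗ_star, star_add]

instance : IsScalarTower ℂ I.Quotient I.Quotient where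
  smul_assoc c a b := by
    obtain ⟨a, rfl⟩ := mkₗ_surjective a
    obtain ⟨b, rfl⟩ := mkₗ_surjective b
    simp only [smul_eq_mul, ← map_smul, ← mkₗ_mul, smul_mul_assoc]

instance : SMulCommClass ℂ I.Quotient I.Quotient where
  smul_comm c a b := by
    obtain ⟨a, rfl⟩ := mkₗ_surjective a
    obtain ⟨b, rfl⟩ := mkₗ_surjective b
    simp only [smul_eq_mul, ← map_smul, ← mkₗ_mul, mul_smul_comm]

instance : StarModule ℂ I.Quotient where
  star_smul c a := by
    obtain ⟨a, rfl⟩ := mkₗ_surjective a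
    simp only [← map_smul, ← mkₗ_star, star_smul]

/-- Multiplication by `1 - e` (computed without a unit) does not increase the norm. -/
theorem norm_sub_mul_le {B : Type u} [NonUnitalCStarAlgebra B] [PartialOrder B]
    [StarOrderedRing B] (y e : B) (he : 0 ≤ e) (he1 : ‖e‖ ≤ 1) : ‖y - y * e‖ ≤ ‖y‖ := by
  have h0 : (0 : Unitization ℂ B) ≤ (e : Unitization ℂ B) := Unitization.inr_nonneg_iff.2 he
  have h1 : (e : Unitization ℂ B) ≤ 1 :=
    (CStarAlgebra.norm_le_one_iff_of_nonneg _ h0).1 (by rwa [Unitization.norm_inr])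
  have h2 : ‖(1 : Unitization ℂ B) - e‖ ≤ 1 :=
    (CStarAlgebra.norm_le_one_iff_of_nonneg _ (sub_nonneg.2 h1)).2 (sub_le_self _ h0)
  calc ‖y - y * e‖ = ‖((y - y * e : B) : Unitization ℂ B)‖ := (Unitization.norm_inr ..).symm
    _ = ‖(y : Unitization ℂ B) * (1 - e)‖ := by
      rw [mul_sub, mul_one, Unitization.inr_sub, Unitization.inr_mul]
    _ ≤ ‖(y : Unitization ℂ B)‖ * ‖(1 : Unitization ℂ B) - e‖ := norm_mul_le _ _
    _ ≤ ‖(y : Unitization ℂ B)‖ * 1 := by gcongr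
    _ = ‖y‖ := by rw [mul_one, Unitization.norm_inr]

/-- The C*-identity on the level of representatives. -/
theorem norm_mkₗ_mul_self_le (x i : A) (hi : i ∈ I) :
    ‖mkₗ I x‖ * ‖mkₗ I x‖ ≤ ‖star x * x + i‖ := by
  let _ : PartialOrder A := CStarAlgebra.spectralOrder A
  have _ : StarOrderedRing A := CStarAlgebra.spectralOrderedRing A
  let _ : NonUnitalCStarAlgebra I := NonUnitalStarSubalgebra.nonUnitalCStarAlgebra I
  let _ : PartialOrder I := CStarAlgebra.spectralOrder I
  have _ : StarOrderedRing I := CStarAlgebra.spectralOrderedRing I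
  refine le_of_forall_pos_lt_add fun ε hε => ?_
  have hu := CStarAlgebra.increasingApproximateUnit I
  have hne := hu.neBot
  have ht := hu.tendsto_mul_left ⟨i, hi⟩
  have hd := Metric.tendsto_nhds.1 ht ε hε
  obtain ⟨e, hd, he0, he1⟩ := (hd.and (hu.eventually_nonneg.and hu.eventually_norm)).exists
  have hE0 : (0 : A) ≤ (e : A) := by
    rw [StarOrderedRing.nonneg_iff] at he0 ⊢
    have := AddSubmonoid.mem_map_of_mem (NonUnitalSubringClass.subtype I).toAddMonoidHom he0
    rw [AddMonoidHom.map_mclosure] at this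
    refine AddSubmonoid.closure_mono ?_ this
    rintro _ ⟨_, ⟨s, rfl⟩, rfl⟩
    exact ⟨(s : A), rfl⟩
  have hE1 : ‖(e : A)‖ ≤ 1 := he1
  have hd' : ‖i - i * (e : A)‖ < ε := by
    rw [dist_comm, dist_eq_norm] at hd
    exact hd
  have hEs : star (e : A) = e := (IsSelfAdjoint.of_nonneg hE0).star_eq
  set y : A := x - x * e with hy
  have hxy : mkₗ I x = mkₗ I y := by
    rw [mkₗ_eq_iff, hy, sub_sub_cancel]
    exact I.mul_mem_left _ e.2
  have h1 : star y * y = (star x * x - star x * x * e) - e * (star x * x - star x * x * e) := by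
    rw [hy, star_sub, star_mul, hEs]
    noncomm_ring
  have h2 : ‖star y * y‖ ≤ ‖star x * x - star x * x * e‖ := by
    rw [h1]
    set w := star x * x - star x * x * (e : A)
    have := norm_sub_mul_le (star w) (e : A) hE0 hE1
    have h3 : star (star w - star w * (e : A)) = w - e * w := by
      rw [star_sub, star_mul, hEs, star_star]
    rwa [← norm_star (star w - star w * (e : A)), h3, norm_star] at this
  calc ‖mkₗ I x‖ * ‖mkₗ I x‖ = ‖mkₗ I y‖ * ‖mkₗ I y‖ := by rw [hxy]
    _ ≤ ‖y‖ * ‖y‖ := by gcongr <;> exact norm_mkₗ_le _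
    _ = ‖star y * y‖ := CStarRing.norm_star_mul_self.symm
    _ ≤ ‖star x * x - star x * x * e‖ := h2
    _ = ‖((star x * x + i) - (star x * x + i) * e) - (i - i * e)‖ := by
      congr 1; noncomm_ring
    _ ≤ ‖(star x * x + i) - (star x * x + i) * e‖ + ‖i - i * e‖ := norm_sub_le _ _
    _ < ‖star x * x + i‖ + ε := add_lt_add_of_le_of_lt (norm_sub_mul_le _ _ hE0 hE1) hd'

instance : CStarRing I.Quotient where
  norm_mul_self_le x := by
    obtain ⟨x, rfl⟩ := mkₗ_surjective x
    refine le_of_forall_pos_lt_add fun ε hε => ?_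
    obtain ⟨a, ha, hlt⟩ := exists_norm_lt (star (mkₗ I x) * mkₗ I x) hε
    refine lt_of_le_of_lt ?_ hlt
    rw [← mkₗ_star, ← mkₗ_mul, mkₗ_eq_iff] at ha
    simpa using norm_mkₗ_mul_self_le x _ ha

instance : NonUnitalCStarAlgebra I.Quotient where

/-- A quotient C*-algebra carries its canonical order. -/
instance : PartialOrder I.Quotient := CStarAlgebra.spectralOrder I.Quotient

instance : StarOrderedRing I.Quotient := CStarAlgebra.spectralOrderedRing I.Quotient

variable (I) in
/-- The quotient map `A → A / I`. -/
def mk : A →⋆ₙₐ[ℂ] I.Quotient where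
  toFun := mkₗ I
  map_smul' := (mkₗ I).map_smul
  map_zero' := (mkₗ I).map_zero
  map_add' := (mkₗ I).map_add
  map_mul' := mkₗ_mul
  map_star' := mkₗ_star

/-- The *-homomorphism `A / I → B / J` induced by a *-homomorphism `A → B` mapping `I` to `J`. -/
def map {B : Type v} [NonUnitalCStarAlgebra B] (I : ClosedIdeal A) (J : ClosedIdeal B)
    (f : A →⋆ₙₐ[ℂ] B) (h : ∀ x ∈ I, f x ∈ J) : I.Quotient →⋆ₙₐ[ℂ] J.Quotient where
  toFun := Submodule.mapQ I.toSubmodule J.toSubmodule (f : A →ₗ[ℂ] B) h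
  map_smul' := map_smul _
  map_zero' := map_zero _
  map_add' := map_add _
  map_mul' x y := by
    obtain ⟨x, rfl⟩ := mkₗ_surjective x
    obtain ⟨y, rfl⟩ := mkₗ_surjective y
    exact congrArg (mkₗ J) (map_mul f x y)
  map_star' x := by
    obtain ⟨x, rfl⟩ := mkₗ_surjective x
    exact congrArg (mkₗ J) (map_star f x)

end Quotient

end ClosedIdeal

/-! ### The sequence algebra and the relative central sequence algebra -/

section CentralSequences

variable {A : Type u} [NonUnitalCStarAlgebra A]

/-- The C*-algebra `ℓ^∞(ℕ, A)` of bounded sequences in `A`. -/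
abbrev BddSeq (A : Type u) [NonUnitalCStarAlgebra A] : Type u := lp (fun _ : ℕ => A) ∞

/-- The ideal `c₀(ℕ, A)` of sequences in `A` that converge to zero. -/
def c0 (A : Type u) [NonUnitalCStarAlgebra A] : ClosedIdeal (BddSeq A) where
  carrier := {x | Tendsto (fun n => x n) atTop (𝓝 0)}
  add_mem' {x y} hx hy := by simpa using Tendsto.add hx hy
  zero_mem' := by simp
  smul_mem' c x hx := by simpa using Tendsto.const_smul hx c
  mul_mem_left' a x hx := by
    have hx' : Tendsto (fun n => x n) atTop (𝓝 0) := hx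
    refine squeeze_zero_norm (a := fun n => ‖a‖ * ‖x n‖) (fun n => ?_) ?_
    · calc ‖(a * x) n‖ = ‖a n * x n‖ := rfl
        _ ≤ ‖a n‖ * ‖x n‖ := norm_mul_le _ _
        _ ≤ ‖a‖ * ‖x n‖ := by gcongr; exact lp.norm_apply_le_norm (by simp) a n
    · simpa using hx'.norm.const_mul ‖a‖
  mul_mem_right' a x hx := by
    have hx' : Tendsto (fun n => x n) atTop (𝓝 0) := hx
    refine squeeze_zero_norm (a := fun n => ‖x n‖ * ‖a‖) (fun n => ?_) ?_
    · calc ‖(x * a) n‖ = ‖x n * a n‖ := rfl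
        _ ≤ ‖x n‖ * ‖a n‖ := norm_mul_le _ _
        _ ≤ ‖x n‖ * ‖a‖ := by gcongr; exact lp.norm_apply_le_norm (by simp) a n
    · simpa using hx'.norm.mul_const ‖a‖
  star_mem' x hx := by
    have hx' : Tendsto (fun n => x n) atTop (𝓝 0) := hx
    simpa using hx'.star
  isClosed' := by
    refine isClosed_of_closure_subset fun x hx => ?_
    refine Metric.tendsto_atTop.2 fun ε hε => ?_
    obtain ⟨y, hy, hxy⟩ := Metric.mem_closure_iff.1 hx (ε / 2) (half_pos hε)
    obtain ⟨N, hN⟩ := Metric.tendsto_atTop.1 hy (ε / 2) (half_pos hε)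
    refine ⟨N, fun n hn => ?_⟩
    have h1 : dist (x n) (y n) ≤ dist x y := by
      rw [dist_eq_norm, dist_eq_norm]
      exact lp.norm_apply_le_norm (by simp) (x - y) n
    calc dist (x n) 0 ≤ dist (x n) (y n) + dist (y n) 0 := dist_triangle _ _ _
      _ < ε / 2 + ε / 2 := add_lt_add (h1.trans_lt hxy) (hN n hn)
      _ = ε := add_halves ε

/-- The sequence algebra `A_∞ = ℓ^∞(ℕ, A) / c₀(ℕ, A)`. -/
abbrev AInf (A : Type u) [NonUnitalCStarAlgebra A] : Type u := (c0 A).Quotient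

/-- The constant sequence with value `a`. -/
def constSeq (a : A) : BddSeq A :=
  ⟨fun _ => a, memℓp_infty ⟨‖a‖, by rintro _ ⟨_, rfl⟩; exact le_rfl⟩⟩

/-- The embedding of `A` into `A_∞` as (classes of) constant sequences. -/
def toAInf (a : A) : AInf A := ClosedIdeal.Quotient.mk (c0 A) (constSeq a)

theorem star_toAInf (a : A) : star (toAInf a) = toAInf (star a) := rfl

/-- The relative commutant `A_∞ ∩ D'`. -/
def relComm (D : NonUnitalStarSubalgebra ℂ A) : NonUnitalStarSubalgebra ℂ (AInf A) where
  carrier := {x | ∀ d ∈ D, x * toAInf d = toAInf d * x}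
  add_mem' hx hy d hd := by rw [add_mul, mul_add, hx d hd, hy d hd]
  zero_mem' d _ := by rw [zero_mul, mul_zero]
  mul_mem' {x y} hx hy d hd := by
    rw [mul_assoc, hy d hd, ← mul_assoc, hx d hd, mul_assoc]
  smul_mem' c x hx d hd := by rw [smul_mul_assoc, mul_smul_comm, hx d hd]
  star_mem' {x} hx d hd := by
    have h := congrArg star (hx (star d) (star_mem hd))
    rw [star_mul, star_mul, star_toAInf, star_star] at h
    exact h.symm

instance (D : NonUnitalStarSubalgebra ℂ A) : IsClosed (relComm D : Set (AInf A)) := by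
  have : (relComm D : Set (AInf A)) = ⋂ d ∈ D, {x | x * toAInf d = toAInf d * x} := by
    ext x
    simp only [Set.mem_iInter]
    rfl
  rw [this]
  exact isClosed_biInter fun d _ => isClosed_eq (by fun_prop) (by fun_prop)

/-- The annihilator `Ann(D, A_∞)`, as an ideal of `A_∞ ∩ D'`. -/
def ann (D : NonUnitalStarSubalgebra ℂ A) : ClosedIdeal (relComm D) where
  carrier := {x | ∀ d ∈ D, (x : AInf A) * toAInf d = 0 ∧ toAInf d * (x : AInf A) = 0}
  add_mem' {x y} hx hy d hd := by
    simp [add_mul, mul_add, (hx d hd).1, (hx d hd).2, (hy d hd).1, (hy d hd).2]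
  zero_mem' d _ := by simp
  smul_mem' c x hx d hd := by
    simp [smul_mul_assoc, mul_smul_comm, (hx d hd).1, (hx d hd).2]
  mul_mem_left' a x hx d hd := by
    have h : (a : AInf A) * (x : AInf A) * toAInf d = 0 := by
      rw [mul_assoc, (hx d hd).1, mul_zero]
    exact ⟨h, ((a * x).2 d hd).symm.trans h⟩
  mul_mem_right' a x hx d hd := by
    have h : toAInf d * ((x : AInf A) * (a : AInf A)) = 0 := by
      rw [← mul_assoc, (hx d hd).2, zero_mul]
    exact ⟨((x * a).2 d hd).trans h, h⟩
  star_mem' x hx d hd := by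
    have h := hx (star d) (star_mem hd)
    have h1 := congrArg star h.1
    have h2 := congrArg star h.2
    rw [star_mul, star_toAInf, star_star, star_zero] at h1 h2
    exact ⟨h2, h1⟩
  isClosed' := by
    have : {x : relComm D | ∀ d ∈ D, (x : AInf A) * toAInf d = 0 ∧ toAInf d * (x : AInf A) = 0} =
        ⋂ d ∈ D, {x : relComm D | (x : AInf A) * toAInf d = 0 ∧ toAInf d * (x : AInf A) = 0} := by
      ext x
      simp only [Set.mem_iInter]
      rfl
    change IsClosed {x : relComm D | ∀ d ∈ D,
      (x : AInf A) * toAInf d = 0 ∧ toAInf d * (x : AInf A) = 0}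
    rw [this]
    exact isClosed_biInter fun d _ =>
      (isClosed_eq (by fun_prop) (by fun_prop)).inter (isClosed_eq (by fun_prop) (by fun_prop))

/-- Kirchberg's relative central sequence algebra `F(D, A) = (A_∞ ∩ D') / Ann(D, A_∞)`. -/
abbrev centralSeq (D : NonUnitalStarSubalgebra ℂ A) : Type u := (ann D).Quotient

end CentralSequences

/-! ### Induced actions -/

section Actions

variable {A : Type u} [NonUnitalCStarAlgebra A]

/-- The *-homomorphism of `ℓ^∞(ℕ, A)` applying a *-automorphism of `A` to every entry. -/
def bddSeqMap (f : A ≃⋆ₐ[ℂ] A) : BddSeq A →⋆ₙₐ[ℂ] BddSeq A where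
  toFun x := ⟨fun n => f (x n), memℓp_infty ⟨‖x‖, by
    rintro _ ⟨n, rfl⟩
    exact (NonUnitalStarAlgHom.norm_apply_le f (x n)).trans
      (lp.norm_apply_le_norm (by simp) x n)⟩⟩
  map_smul' c x := by ext n; exact map_smul f c (x n)
  map_zero' := by ext n; exact map_zero f
  map_add' x y := by ext n; exact map_add f (x n) (y n)
  map_mul' x y := by ext n; exact map_mul f (x n) (y n)
  map_star' x := by ext n; exact map_star f (x n)

/-- The map induced on `A_∞` by a *-automorphism of `A`. -/
def aInfMap (f : A ≃⋆ₐ[ℂ] A) : AInf A →⋆ₙₐ[ℂ] AInf A :=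
  ClosedIdeal.Quotient.map (c0 A) (c0 A) (bddSeqMap f) (fun x hx => by
    have hx' : Tendsto (fun n => x n) atTop (𝓝 0) := hx
    have hf : Continuous f := (StarAlgEquiv.isometry f).continuous
    have h := (hf.tendsto 0).comp hx'
    rw [map_zero] at h
    exact h)

theorem aInfMap_toAInf (f : A ≃⋆ₐ[ℂ] A) (a : A) : aInfMap f (toAInf a) = toAInf (f a) := rfl

variable {G : Type v} [Group G]

/-- `D` is invariant under the action `α` of `G` on `A`. -/
def IsInvariant (α : G →* (A ≃⋆ₐ[ℂ] A)) (D : NonUnitalStarSubalgebra ℂ A) : Prop :=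
  ∀ g : G, ∀ d ∈ D, α g d ∈ D

variable (α : G →* (A ≃⋆ₐ[ℂ] A)) (D : NonUnitalStarSubalgebra ℂ A)

theorem exists_preimage (hD : IsInvariant α D) (g : G) (d : A) (hd : d ∈ D) : ∃ d' ∈ D, α g d' = d := by
  refine ⟨α g⁻¹ d, hD _ _ hd, ?_⟩
  rw [← StarAlgEquiv.mul_apply, ← map_mul, mul_inv_cancel, map_one, StarAlgEquiv.one_apply]

/-- The action of `g` on `A_∞ ∩ D'`, for an invariant subalgebra `D`. -/
def relCommAct (hD : IsInvariant α D) (g : G) : relComm D →⋆ₙₐ[ℂ] relComm D :=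
  NonUnitalStarAlgHom.codRestrict
    ((aInfMap (α g)).comp (NonUnitalStarSubalgebraClass.subtype (relComm D))) (relComm D)
    (fun x d hd => by
      obtain ⟨d', hd', rfl⟩ := exists_preimage α D hD g d hd
      change aInfMap (α g) (x : AInf A) * _ = _ * aInfMap (α g) (x : AInf A)
      rw [← aInfMap_toAInf, ← map_mul, ← map_mul, x.2 d' hd'])

/-- The induced action `α̃_∞` of `G` on `F(D, A)`, for an invariant subalgebra `D`. -/
def centralAct (hD : IsInvariant α D) (g : G) : centralSeq D →⋆ₙₐ[ℂ] centralSeq D :=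
  ClosedIdeal.Quotient.map (ann D) (ann D) (relCommAct α D hD g) (fun x hx d hd => by
    obtain ⟨d', hd', rfl⟩ := exists_preimage α D hD g d hd
    change aInfMap (α g) (x : AInf A) * _ = 0 ∧ _ * aInfMap (α g) (x : AInf A) = 0
    rw [← aInfMap_toAInf, ← map_mul, ← map_mul, (hx d' hd').1, (hx d' hd').2, map_zero]
    exact ⟨rfl, rfl⟩)

end Actions

/-! ### Rokhlin dimension -/

section Rokhlin

/-- Orthogonality `a ⊥ b`. -/
def Orth {A : Type u} [NonUnitalCStarAlgebra A] (a b : A) : Prop :=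
  a * b = 0 ∧ b * a = 0 ∧ star a * b = 0 ∧ star b * a = 0

/-- Maps which are contractive and of order zero. -/
structure IsContractiveOrderZero {A : Type u} {B : Type v} [NonUnitalCStarAlgebra A]
    [NonUnitalCStarAlgebra B] (φ : A → B) : Prop where
  contractive : ∀ a, ‖φ a‖ ≤ ‖a‖
  orderZero : ∀ a b, Orth a b → Orth (φ a) (φ b)

/-- `e` is the unit of `A`. -/
def IsUnitOf {A : Type u} [NonUnitalCStarAlgebra A] (e : A) : Prop :=
  ∀ x : A, e * x = x ∧ x * e = x

variable {G : Type v} [Group G]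

instance (H : Subgroup G) [H.FiniteIndex] : Fintype (G ⧸ H) :=
  H.fintypeQuotientOfFiniteIndex

/-- The C*-algebra `C(G/H)` of functions on the finite discrete set of left cosets of `H`. -/
abbrev CosetFun (H : Subgroup G) : Type v := G ⧸ H → ℂ

/-- The action `σ^H` of `G` on `C(G/H)` by left translation. -/
def leftTranslate (H : Subgroup G) (g : G) (f : CosetFun H) : CosetFun H :=
  fun x => f (g⁻¹ • x)

variable {A : Type u} [NonUnitalCStarAlgebra A]

/-- `φ₀, …, φ_d` are equivariant c.c.p. order zero maps `C(G/H) → F(D, A)` such that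
`φ₀(1) + ⋯ + φ_d(1)` is the unit of `F(D, A)`. -/
structure IsRokhlinFamily (α : G →* (A ≃⋆ₐ[ℂ] A)) (H : Subgroup G) [H.FiniteIndex]
    (D : NonUnitalStarSubalgebra ℂ A) (hD : IsInvariant α D) {d : ℕ}
    (φ : Fin (d + 1) → CompletelyPositiveMap (CosetFun H) (centralSeq D)) : Prop where
  contractive_orderZero : ∀ l, IsContractiveOrderZero (φ l)
  equivariant : ∀ l g f, φ l (leftTranslate H g f) = centralAct α D hD g (φ l f)
  sum_one : IsUnitOf (∑ l, φ l 1)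

/-- The maps `φ₀, …, φ_d` have pairwise commuting ranges. -/
def CommutingRanges {B : Type u} {C : Type v} [Mul C] {d : ℕ} (φ : Fin (d + 1) → B → C) : Prop :=
  ∀ k l, k ≠ l → ∀ x y, Commute (φ k x) (φ l y)

/-- For every separable `α`-invariant C*-subalgebra `D` of `A` there are `d + 1` maps as in the
definition of the Rokhlin dimension relative to `H`. -/
def HasRokhlinFamilies (α : G →* (A ≃⋆ₐ[ℂ] A)) (H : Subgroup G) [H.FiniteIndex] (d : ℕ) : Prop :=
  ∀ D : NonUnitalStarSubalgebra ℂ A, IsClosed (D : Set A) →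
    TopologicalSpace.IsSeparable (D : Set A) → ∀ hD : IsInvariant α D,
      ∃ φ : Fin (d + 1) → CompletelyPositiveMap (CosetFun H) (centralSeq D),
        IsRokhlinFamily α H D hD φ

/-- The same as `HasRokhlinFamilies`, with commuting towers. -/
def HasCommutingRokhlinFamilies (α : G →* (A ≃⋆ₐ[ℂ] A)) (H : Subgroup G) [H.FiniteIndex]
    (d : ℕ) : Prop :=
  ∀ D : NonUnitalStarSubalgebra ℂ A, IsClosed (D : Set A) →
    TopologicalSpace.IsSeparable (D : Set A) → ∀ hD : IsInvariant α D,
      ∃ φ : Fin (d + 1) → CompletelyPositiveMap (CosetFun H) (centralSeq D),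
        IsRokhlinFamily α H D hD φ ∧ CommutingRanges fun l => ⇑(φ l)

/-- The Rokhlin dimension `dim_Rok(α, H)` relative to a subgroup `H` of finite index:
the least `d` as above, and `⊤` if there is none. -/
def dimRokRel (α : G →* (A ≃⋆ₐ[ℂ] A)) (H : Subgroup G) [H.FiniteIndex] : ℕ∞ :=
  ⨅ (d : ℕ) (_ : HasRokhlinFamilies α H d), (d : ℕ∞)

/-- The Rokhlin dimension with commuting towers `dim_Rok^c(α, H)` relative to `H`. -/
def dimRokCRel (α : G →* (A ≃⋆ₐ[ℂ] A)) (H : Subgroup G) [H.FiniteIndex] : ℕ∞ :=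
  ⨅ (d : ℕ) (_ : HasCommutingRokhlinFamilies α H d), (d : ℕ∞)

/-- The Rokhlin dimension `dim_Rok(α)`. -/
def dimRok (α : G →* (A ≃⋆ₐ[ℂ] A)) : ℕ∞ :=
  ⨆ (H : Subgroup G) (_ : H.FiniteIndex), dimRokRel α H

/-- The Rokhlin dimension with commuting towers `dim_Rok^c(α)`. -/
def dimRokC (α : G →* (A ≃⋆ₐ[ℂ] A)) : ℕ∞ :=
  ⨆ (H : Subgroup G) (_ : H.FiniteIndex), dimRokCRel α H

end Rokhlin

/-! ### Amenability and extensions -/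

open scoped Pointwise symmDiff in
/-- A discrete group is amenable if it has Følner sets: for every finite `M ⊆ G` and every `ε > 0`
there is a non-empty finite `K ⊆ G` with `|sK Δ K| < ε |K|` for all `s ∈ M`. -/
def IsAmenable (G : Type v) [Group G] : Prop :=
  ∀ (M : Set G), M.Finite → ∀ ε : ℝ, 0 < ε →
    ∃ K : Set G, K.Finite ∧ K.Nonempty ∧
      ∀ s ∈ M, (((s • K) ∆ K).ncard : ℝ) < ε * (K.ncard : ℝ)

/-- `0 → (J, α) → (A, β) → (B, γ) → 0` is a short exact sequence of `G`-algebras. -/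
structure IsEquivariantExtension {G : Type*} [Group G] {J A B : Type*}
    [NonUnitalCStarAlgebra J] [NonUnitalCStarAlgebra A] [NonUnitalCStarAlgebra B]
    (α : G →* (J ≃⋆ₐ[ℂ] J)) (β : G →* (A ≃⋆ₐ[ℂ] A)) (γ : G →* (B ≃⋆ₐ[ℂ] B))
    (ι : J →⋆ₙₐ[ℂ] A) (π : A →⋆ₙₐ[ℂ] B) : Prop where
  injective : Function.Injective ι
  exact : Function.Exact ι π
  surjective : Function.Surjective π
  equivariant_left : ∀ g j, ι (α g j) = β g (ι j)
  equivariant_right : ∀ g a, π (β g a) = γ g (π a)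

end RokhlinDim

end

noncomputable section

namespace RokhlinDim

universe u v w

/-! ### Functoriality of the sequence algebra -/

section SequenceAlgebra

variable {A : Type u} {B : Type v} {C : Type w} [NonUnitalCStarAlgebra A] [NonUnitalCStarAlgebra B]
  [NonUnitalCStarAlgebra C]

/-! Fix `H`. A Rokhlin family is determined by the images of the point masses of C(G/H). Lifted to
A_∞, these are positive elements a_{l,x} satisfying polynomial relations multiplied by elements z:
commutation with z, orthogonality within a tower, equivariance, total sum acting as a unit on z,
and, if the proposition `c` holds, commutation of different towers. Taking `c` false or true treats
both inequalities at once. `HasFamilies.hasTowers` and `HasTowers.hasFamilies` translate between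
families and towers. A diagonal argument (`hasTowers_of_forall_subalgebra`) lets z range over any
separable subset of A_∞, not only over constant sequences; this is what makes successive choices
possible.

For an extension and a separable Z in A_∞, take towers over π(Z) in B_∞ and lift them to positive b
in A_∞. Their relations over Z now fail only by elements of J_∞. Let C be the *-algebra generated by
Z, the b and their translates. There is an invariant positive contraction e in J_∞ which commutes
with C and is a unit for C ∩ J_∞. Hence 1 - e kills all the errors, and the (1 - e)b are towers with
sum 1 - e. Next take towers a in J_∞ over e and eC; the ea have sum e and commute with the (1 - e)b
over Z. Together they are towers over Z (`isTower_glue`), (m + 1) + (n + 1) in number, which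
explains the extra 1 in the estimate.

The element e comes from an approximate unit of J (`exists_quasicentral`). Commutators and
differences α_g(e) - e need not be small along it, but those of successive, sparsely chosen members
are almost orthogonal, so their averages are small in norm (`exists_mem_norm_lt_of_convex`). A
diagonal argument over countably many conditions then gives exact relations in J_∞. -/

theorem continuous_starHom (f : A →⋆ₙₐ[ℂ] B) : Continuous f :=
  AddMonoidHomClass.continuous_of_bound f 1 fun x => by
    simpa using NonUnitalStarAlgHom.norm_apply_le f x

/-- The class in `A_∞` of a bounded sequence. -/
def cls : BddSeq A →⋆ₙₐ[ℂ] AInf A := ClosedIdeal.Quotient.mk (c0 A)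

theorem cls_surjective : Function.Surjective (cls : BddSeq A → AInf A) :=
  ClosedIdeal.Quotient.mkₗ_surjective

theorem cls_eq_iff {x y : BddSeq A} :
    cls x = cls y ↔ Tendsto (fun n => x n - y n) atTop (𝓝 0) :=
  ClosedIdeal.Quotient.mkₗ_eq_iff

theorem cls_eq_zero_iff {x : BddSeq A} : cls x = 0 ↔ Tendsto (fun n => x n) atTop (𝓝 0) := by
  rw [← map_zero (cls (A := A)), cls_eq_iff]
  simp

/-- The bounded sequence with given terms. -/
def bddSeqOf (x : ℕ → A) (C : ℝ) (h : ∀ n, ‖x n‖ ≤ C) : BddSeq A :=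
  ⟨x, memℓp_infty ⟨C, by rintro _ ⟨n, rfl⟩; exact h n⟩⟩

@[simp]
theorem bddSeqOf_apply (x : ℕ → A) (C : ℝ) (h : ∀ n, ‖x n‖ ≤ C) (n : ℕ) :
    bddSeqOf x C h n = x n := rfl

theorem norm_bddSeq_apply_le (x : BddSeq A) (n : ℕ) : ‖x n‖ ≤ ‖x‖ :=
  lp.norm_apply_le_norm (by simp) x n

/-- Evaluation of bounded sequences at `n`. -/
def evalSeq (n : ℕ) : BddSeq A →⋆ₙₐ[ℂ] A where
  toFun x := x n
  map_smul' _ _ := rfl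
  map_zero' := rfl
  map_add' _ _ := rfl
  map_mul' _ _ := rfl
  map_star' _ := rfl

/-- The embedding of `A` in `A_∞`, as a *-homomorphism. -/
def constHom : A →⋆ₙₐ[ℂ] AInf A where
  toFun := toAInf
  map_smul' _ _ := rfl
  map_zero' := rfl
  map_add' _ _ := rfl
  map_mul' _ _ := rfl
  map_star' _ := rfl

theorem continuous_toAInf : Continuous (toAInf : A → AInf A) :=
  continuous_starHom (constHom (A := A))

/-- The map on bounded sequences induced by a *-homomorphism. -/
def seqMap (f : A →⋆ₙₐ[ℂ] B) : BddSeq A →⋆ₙₐ[ℂ] BddSeq B where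
  toFun x := bddSeqOf (fun n => f (x n)) ‖x‖ fun n =>
    (NonUnitalStarAlgHom.norm_apply_le f (x n)).trans (norm_bddSeq_apply_le x n)
  map_smul' c x := by ext n; exact map_smul f c (x n)
  map_zero' := by ext n; exact map_zero f
  map_add' x y := by ext n; exact map_add f (x n) (y n)
  map_mul' x y := by ext n; exact map_mul f (x n) (y n)
  map_star' x := by ext n; exact map_star f (x n)

@[simp]
theorem seqMap_apply (f : A →⋆ₙₐ[ℂ] B) (x : BddSeq A) (n : ℕ) : seqMap f x n = f (x n) := rfl

/-- The map on sequence algebras induced by a *-homomorphism. -/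
def infMap (f : A →⋆ₙₐ[ℂ] B) : AInf A →⋆ₙₐ[ℂ] AInf B :=
  ClosedIdeal.Quotient.map (c0 A) (c0 B) (seqMap f) (fun x hx => by
    have hx' : Tendsto (fun n => x n) atTop (𝓝 0) := hx
    have h := ((continuous_starHom f).tendsto 0).comp hx'
    rw [map_zero] at h
    exact h)

@[simp]
theorem infMap_cls (f : A →⋆ₙₐ[ℂ] B) (x : BddSeq A) : infMap f (cls x) = cls (seqMap f x) := rfl

@[simp]
theorem infMap_toAInf (f : A →⋆ₙₐ[ℂ] B) (a : A) : infMap f (toAInf a) = toAInf (f a) := rfl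

theorem aInfMap_cls (f : A ≃⋆ₐ[ℂ] A) (x : BddSeq A) : aInfMap f (cls x) = cls (bddSeqMap f x) := rfl

/-- Injective *-homomorphisms are isometric, so a sequence is null as soon as its image is. -/
theorem infMap_injective {f : A →⋆ₙₐ[ℂ] B} (hf : Function.Injective f) :
    Function.Injective (infMap f) := by
  refine (injective_iff_map_eq_zero _).2 fun x hx => ?_
  obtain ⟨x, rfl⟩ := cls_surjective x
  rw [infMap_cls, cls_eq_zero_iff] at hx
  rw [cls_eq_zero_iff]
  rw [tendsto_zero_iff_norm_tendsto_zero] at hx ⊢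
  simpa [NonUnitalStarAlgHom.norm_map f hf] using hx

/-- Bounded lifting along a surjective *-homomorphism. -/
theorem exists_norm_lift {f : A →⋆ₙₐ[ℂ] B} (hf : Function.Surjective f) :
    ∃ C : ℝ, 0 < C ∧ ∀ b : B, ∃ a : A, f a = b ∧ ‖a‖ ≤ C * ‖b‖ :=
  ContinuousLinearMap.exists_preimage_norm_le
    (⟨(f : A →ₗ[ℂ] B), continuous_starHom f⟩ : A →L[ℂ] B) hf

theorem infMap_surjective {f : A →⋆ₙₐ[ℂ] B} (hf : Function.Surjective f) :
    Function.Surjective (infMap f) := by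
  intro y
  obtain ⟨y, rfl⟩ := cls_surjective y
  obtain ⟨C, hC, h⟩ := exists_norm_lift hf
  choose s hs hsn using h
  refine ⟨cls (bddSeqOf (fun n => s (y n)) (C * ‖y‖) fun n => (hsn _).trans ?_), ?_⟩
  · gcongr
    exact norm_bddSeq_apply_le y n
  · rw [infMap_cls]
    congr 1
    ext n
    simp [hs]

/-- If g(y_n) → 0, subtracting norm-controlled lifts of g(y_n) changes y by a null sequence and
moves every term into the kernel. The preimages under f are bounded because f is isometric. -/
theorem infMap_exact {f : A →⋆ₙₐ[ℂ] B} {g : B →⋆ₙₐ[ℂ] C} (hf : Function.Injective f)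
    (hfg : Function.Exact f g) (hg : Function.Surjective g) :
    Function.Exact (infMap f) (infMap g) := by
  intro y
  constructor
  · intro hy
    obtain ⟨y, rfl⟩ := cls_surjective y
    obtain ⟨K, hK, h⟩ := exists_norm_lift hg
    choose s hs hsn using h
    have h1 : ∀ n, ∃ x, f x = y n - s (g (y n)) := fun n =>
      (hfg _).1 (by rw [map_sub, hs, sub_self])
    choose x hx using h1
    have hxn : ∀ n, ‖x n‖ ≤ ‖y‖ + K * ‖y‖ := fun n => by
      rw [← NonUnitalStarAlgHom.norm_map f hf, hx]
      refine (norm_sub_le _ _).trans (add_le_add (norm_bddSeq_apply_le y n) ((hsn _).trans ?_))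
      gcongr
      exact (NonUnitalStarAlgHom.norm_apply_le g _).trans (norm_bddSeq_apply_le y n)
    refine ⟨cls (bddSeqOf x _ hxn), ?_⟩
    rw [infMap_cls, cls_eq_iff]
    rw [infMap_cls, cls_eq_zero_iff] at hy
    refine squeeze_zero_norm (a := fun n => K * ‖g (y n)‖) (fun n => ?_) ?_
    · simp only [seqMap_apply, bddSeqOf_apply, hx]
      rw [sub_sub_cancel_left, norm_neg]
      exact hsn _
    · simpa using hy.norm.const_mul K
  · rintro ⟨x, rfl⟩
    obtain ⟨x, rfl⟩ := cls_surjective x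
    rw [infMap_cls, infMap_cls, cls_eq_zero_iff]
    simp [hfg.apply_apply_eq_zero]

/-- Positive elements lift along surjective *-homomorphisms. -/
theorem exists_nonneg_lift [PartialOrder A] [StarOrderedRing A] [PartialOrder B]
    [StarOrderedRing B] {f : A →⋆ₙₐ[ℂ] B} (hf : Function.Surjective f) {b : B} (hb : 0 ≤ b) :
    ∃ a, 0 ≤ a ∧ f a = b := by
  obtain ⟨y, rfl⟩ := CStarAlgebra.nonneg_iff_eq_star_mul_self.1 hb
  obtain ⟨x, rfl⟩ := hf y
  exact ⟨star x * x, star_mul_self_nonneg x, by rw [map_mul, map_star]⟩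

end SequenceAlgebra

/-! ### Separability -/

section Separability

open TopologicalSpace

variable {A : Type u} [NonUnitalCStarAlgebra A]

theorem isSeparable_subsemigroup_closure {s : Set A} (hs : IsSeparable s) :
    IsSeparable (Subsemigroup.closure s : Set A) := by
  -- `S n` consists of the products of n + 1 elements of `s`, a continuous image of a separable set.
  let S : ℕ → Set A := fun n => Nat.rec s (fun _ T => (fun p : A × A => p.1 * p.2) '' (T ×ˢ s)) n
  have hS : ∀ n, IsSeparable (S n) := fun n => by
    induction n with
    | zero => exact hs
    | succ n ih => exact (ih.prod hs).image continuous_mul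
  refine (IsSeparable.iUnion hS).mono fun x hx => ?_
  -- Membership alone does not pass to products; the induction also carries stability of the union
  -- under right multiplication by x.
  have : x ∈ (⋃ n, S n) ∧ ∀ t ∈ ⋃ n, S n, t * x ∈ ⋃ n, S n := by
    induction hx using Subsemigroup.closure_induction with
    | mem x hx =>
      refine ⟨Set.mem_iUnion.2 ⟨0, hx⟩, fun t ht => ?_⟩
      obtain ⟨n, hn⟩ := Set.mem_iUnion.1 ht
      exact Set.mem_iUnion.2 ⟨n + 1, (t, x), ⟨hn, hx⟩, rfl⟩
    | mul x y _ _ hx hy =>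
      refine ⟨hy.2 _ hx.1, fun t ht => ?_⟩
      rw [← mul_assoc]
      exact hy.2 _ (hx.2 _ ht)
  exact this.1

theorem isSeparable_adjoin {s : Set A} (hs : IsSeparable s) :
    IsSeparable (NonUnitalStarAlgebra.adjoin ℂ s : Set A) := by
  have h : IsSeparable (s ∪ star s) := by
    refine hs.union ?_
    rw [← Set.image_star]
    exact hs.image continuous_star
  have h2 := (isSeparable_subsemigroup_closure h).span (R := ℂ)
  rw [← NonUnitalAlgebra.adjoin_eq_span] at h2
  exact h2

variable {G : Type v} [Group G]

/-- A separable set is contained in a separable invariant C*-subalgebra, for countable groups. -/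
theorem exists_invariant_subalgebra [Countable G] (α : G →* (A ≃⋆ₐ[ℂ] A)) {s : Set A}
    (hs : IsSeparable s) : ∃ D : NonUnitalStarSubalgebra ℂ A,
      IsClosed (D : Set A) ∧ IsSeparable (D : Set A) ∧ IsInvariant α D ∧ s ⊆ D := by
  let S : Set A := ⋃ g : G, α g '' s
  let D₀ := NonUnitalStarAlgebra.adjoin ℂ S
  have hcont : ∀ g, Continuous (α g) := fun g => (StarAlgEquiv.isometry (α g)).continuous
  have hS : IsSeparable S := IsSeparable.iUnion fun g => hs.image (hcont g)
  have hinv : ∀ g, ∀ x ∈ D₀, α g x ∈ D₀ := fun g x hx => by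
    induction hx using NonUnitalStarAlgebra.adjoin_induction with
    | mem x hx =>
      obtain ⟨k, y, hy, rfl⟩ := Set.mem_iUnion.1 hx
      refine NonUnitalStarAlgebra.subset_adjoin ℂ S (Set.mem_iUnion.2 ⟨g * k, y, hy, ?_⟩)
      rw [map_mul, StarAlgEquiv.mul_apply]
    | zero => rw [map_zero]; exact zero_mem _
    | add x y _ _ hx hy => rw [map_add]; exact add_mem hx hy
    | mul x y _ _ hx hy => rw [map_mul]; exact mul_mem hx hy
    | smul c x _ hx => rw [map_smul]; exact SMulMemClass.smul_mem c hx
    | star x _ hx => rw [map_star]; exact star_mem hx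
  refine ⟨D₀.topologicalClosure, D₀.isClosed_topologicalClosure, (isSeparable_adjoin hS).closure,
    fun g => ?_, ?_⟩
  · have h : Set.MapsTo (α g) (D₀ : Set A) D₀ := hinv g
    exact h.closure (hcont g)
  · refine Set.Subset.trans (fun x hx => ?_) D₀.le_topologicalClosure
    refine NonUnitalStarAlgebra.subset_adjoin ℂ S (Set.mem_iUnion.2 ⟨1, x, hx, ?_⟩)
    rw [map_one, StarAlgEquiv.one_apply]

end Separability

/-! ### Towers -/

section Towers

open TopologicalSpace

/-- The relations satisfied by a Rokhlin system of towers `a : L → X → R` over `z`. -/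
inductive TowerRel (G L X : Type*)
  | comm (l : L) (x : X)
  | orth (l : L) (x y : X)
  | equiv (g : G) (l : L) (x : X)
  | sum
  | towers (l : L) (x : X) (k : L) (y : X)

instance {G L X : Type*} [Countable G] [Countable L] [Countable X] :
    Countable (TowerRel G L X) := by
  let f : TowerRel G L X → (L × X) ⊕ (L × X × X) ⊕ (G × L × X) ⊕ Unit ⊕ (L × X × L × X)
    | .comm l x => .inl (l, x)
    | .orth l x y => .inr (.inl (l, x, y))
    | .equiv g l x => .inr (.inr (.inl (g, l, x)))
    | .sum => .inr (.inr (.inr (.inl ())))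
    | .towers l x k y => .inr (.inr (.inr (.inr (l, x, k, y))))
  refine Function.Injective.countable (f := f) fun r s h => ?_
  cases r <;> cases s <;> simp_all [f]

section Ring

variable {G L X R S : Type*} [Group G] [MulAction G X] [Fintype L] [Fintype X]
  [NonUnitalRing R] [NonUnitalRing S]

open Classical in
/-- The elements that vanish when `a` is a system of towers over `z`; the relation that the towers
commute is only imposed when `c` holds. -/
def towerDefect (act : G → R → R) (c : Prop) (a : L → X → R) (z : R) : TowerRel G L X → R
  | .comm l x => a l x * z - z * a l x
  | .orth l x y => if x = y then 0 else a l x * a l y * z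
  | .equiv g l x => (act g (a l x) - a l (g • x)) * z
  | .sum => (∑ l, ∑ x, a l x) * z - z
  | .towers l x k y => if c ∧ l ≠ k then (a l x * a k y - a k y * a l x) * z else 0

/-- Defects are built from ring operations and the action, so equivariant homomorphisms transport
them. This moves relations between sequences, their terms and classes, and along the maps of the
extension. -/
theorem map_towerDefect {F : Type*} [FunLike F R S] [NonUnitalRingHomClass F R S] (f : F)
    {act : G → R → R} {act' : G → S → S} (hf : ∀ g r, f (act g r) = act' g (f r)) (c : Prop)
    (a : L → X → R) (z : R) (r : TowerRel G L X) :
    f (towerDefect act c a z r) = towerDefect act' c (fun l x => f (a l x)) (f z) r := by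
  cases r <;> simp only [towerDefect] <;> try split_ifs
  all_goals simp only [map_sub, map_mul, map_sum, map_zero, hf]

/-- The relations for a system of towers over `z`. -/
structure IsTower (act : G → R → R) (c : Prop) (a : L → X → R) (z : R) : Prop where
  comm : ∀ l x, a l x * z = z * a l x
  orth : ∀ l x y, x ≠ y → a l x * a l y * z = 0
  equiv : ∀ g l x, (act g (a l x) - a l (g • x)) * z = 0
  sum : (∑ l, ∑ x, a l x) * z = z
  towers : c → ∀ l x k y, l ≠ k → (a l x * a k y - a k y * a l x) * z = 0

theorem isTower_iff {act : G → R → R} {c : Prop} {a : L → X → R} {z : R} :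
    IsTower act c a z ↔ ∀ r, towerDefect act c a z r = 0 := by
  constructor
  · rintro ⟨h1, h2, h3, h4, h5⟩ (⟨l, x⟩ | ⟨l, x, y⟩ | ⟨g, l, x⟩ | _ | ⟨l, x, k, y⟩)
    · exact sub_eq_zero.2 (h1 l x)
    · rw [towerDefect]
      split_ifs with h
      exacts [rfl, h2 l x y h]
    · exact h3 g l x
    · exact sub_eq_zero.2 h4
    · rw [towerDefect]
      split_ifs with h
      exacts [h5 h.1 l x k y h.2, rfl]
  · intro h
    refine ⟨fun l x => sub_eq_zero.1 (h (.comm l x)), fun l x y hxy => ?_,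
      fun g l x => h (.equiv g l x), sub_eq_zero.1 (h .sum), fun hc l x k y hlk => ?_⟩
    · simpa [towerDefect, hxy] using h (.orth l x y)
    · simpa [towerDefect, hc, hlk] using h (.towers l x k y)

theorem IsTower.map {F : Type*} [FunLike F R S] [NonUnitalRingHomClass F R S] (f : F)
    {act : G → R → R} {act' : G → S → S} (hf : ∀ g r, f (act g r) = act' g (f r)) {c : Prop}
    {a : L → X → R} {z : R} (h : IsTower act c a z) :
    IsTower act' c (fun l x => f (a l x)) (f z) := by
  rw [isTower_iff] at h ⊢
  intro r
  rw [← map_towerDefect f hf, h, map_zero]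

/-- For fixed towers each defect is continuous in z, so relations need only be checked on a
countable dense set. -/
theorem isClosed_setOf_isTower [TopologicalSpace R] [IsTopologicalRing R] [T1Space R]
    (act : G → R → R) (c : Prop) (a : L → X → R) : IsClosed {z | IsTower act c a z} := by
  simp only [isTower_iff, Set.ofPred_forall]
  refine isClosed_iInter fun r => isClosed_singleton.preimage (f := fun z => towerDefect act c a z r) ?_
  cases r <;> simp only [towerDefect] <;> try split_ifs
  all_goals fun_prop

end Ring

/-- The existence of positive systems of towers in the sequence algebra, indexed by `L`, over any
separable set. -/
def HasTowers {G : Type*} [Group G] {A : Type*} [NonUnitalCStarAlgebra A]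
    (α : G →* (A ≃⋆ₐ[ℂ] A)) (H : Subgroup G) [H.FiniteIndex] (L : Type*) [Fintype L]
    (c : Prop) : Prop :=
  ∀ Z : Set (AInf A), IsSeparable Z → ∃ a : L → G ⧸ H → AInf A,
    (∀ l x, 0 ≤ a l x) ∧ ∀ z ∈ Z, IsTower (fun g => aInfMap (α g)) c a z

/-- A diagonal sequence argument. -/
theorem exists_diagonal_seq {ι X E : Type*} [Countable ι] [SeminormedAddCommGroup E]
    (P : X → Prop) (v : ι → ℕ → X → E)
    (h : ∀ (s : Finset ι) (n : ℕ) (δ : ℝ), 0 < δ → ∃ x, P x ∧ ∀ i ∈ s, ‖v i n x‖ < δ) :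
    ∃ x : ℕ → X, (∀ n, P (x n)) ∧ ∀ i, Tendsto (fun n => v i n (x n)) atTop (𝓝 0) := by
  obtain ⟨e, he⟩ := Countable.exists_injective_nat ι
  have hfin : ∀ n, {i | e i ≤ n}.Finite := fun n =>
    (Set.finite_Iic n).preimage he.injOn
  -- Stage n treats the finitely many indices of code at most n, with tolerance 1/(n + 1).
  choose x hP hx using fun n : ℕ => h (hfin n).toFinset n (1 / ((n : ℝ) + 1)) (by positivity)
  refine ⟨x, hP, fun i => squeeze_zero_norm' ?_ (tendsto_one_div_add_atTop_nhds_zero_nat (𝕜 := ℝ))⟩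
  filter_upwards [eventually_ge_atTop (e i)] with n hn
  exact (hx n i (by simpa using hn)).le

/-- Towers over the constant sequences of every separable invariant subalgebra give towers over
every separable set of sequences. -/
theorem hasTowers_of_forall_subalgebra {G : Type*} [Group G] [Countable G] {A : Type*}
    [NonUnitalCStarAlgebra A] (α : G →* (A ≃⋆ₐ[ℂ] A)) (H : Subgroup G) [H.FiniteIndex]
    {L : Type*} [Fintype L] {c : Prop}
    (h : ∀ D : NonUnitalStarSubalgebra ℂ A, IsClosed (D : Set A) → IsSeparable (D : Set A) →
      IsInvariant α D → ∃ a : L → G ⧸ H → AInf A, (∀ l x, 0 ≤ a l x) ∧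
        ∀ d ∈ D, IsTower (fun g => aInfMap (α g)) c a (toAInf d)) :
    HasTowers α H L c := by
  intro Z hZ
  obtain ⟨Z₀, -, hZc, hZd⟩ := hZ.exists_countable_dense_subset
  have := hZc.to_subtype
  choose ζ hζ using fun z : Z₀ => cls_surjective (z : AInf A)
  -- D contains every term of the chosen representatives of a countable dense subset of Z.
  obtain ⟨D, hD1, hD2, hD3, hD4⟩ := exists_invariant_subalgebra α
    (s := Set.range fun p : Z₀ × ℕ => ζ p.1 p.2) (Set.countable_range _).isSeparable
  obtain ⟨a, ha, hat⟩ := h D hD1 hD2 hD3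
  -- Writing a as y*y keeps positivity when the terms of y are reindexed.
  have hy : ∀ l x, ∃ y : BddSeq A, a l x = star (cls y) * cls y := fun l x => by
    obtain ⟨y, hy⟩ := CStarAlgebra.nonneg_iff_eq_star_mul_self.1 (ha l x)
    obtain ⟨y, rfl⟩ := cls_surjective y
    exact ⟨y, hy⟩
  choose y hy using hy
  -- The defect with the m-th term of the towers against the n-th term of ζ. For fixed n it tends to
  -- 0 in m, the relations holding over the constant sequence ζ(n); the diagonal argument then picks
  -- m(n).
  let v : Z₀ × TowerRel G L (G ⧸ H) → ℕ → ℕ → A := fun p n m =>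
    towerDefect (fun g => α g) c (fun l x => star (y l x m) * y l x m) (ζ p.1 n) p.2
  have hv : ∀ p n, Tendsto (v p n) atTop (𝓝 0) := fun p n => by
    have h1 := isTower_iff.1 (hat (ζ p.1 n) (hD4 ⟨(p.1, n), rfl⟩)) p.2
    have h2 : a = fun l x => cls (star (y l x) * y l x) := by
      funext l x
      rw [hy, map_mul, map_star]
    rw [h2] at h1
    change towerDefect _ c _ (cls (constSeq (ζ p.1 n))) p.2 = 0 at h1
    rw [← map_towerDefect (cls (A := A)) (act := fun g => bddSeqMap (α g)) (fun g r => rfl),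
      cls_eq_zero_iff] at h1
    refine h1.congr fun m => ?_
    exact map_towerDefect (evalSeq (A := A) m) (act' := fun g => α g) (fun g r => rfl) _ _ _ _
  obtain ⟨m, -, hm⟩ := exists_diagonal_seq (fun _ => True) v fun s n δ hδ => by
    have : ∀ᶠ m in atTop, ∀ p ∈ s, ‖v p n m‖ < δ := by
      refine (Filter.eventually_all_finset s).2 fun p _ => ?_
      have := (hv p n).norm
      rw [norm_zero] at this
      exact this.eventually (gt_mem_nhds hδ)
    obtain ⟨m, hm⟩ := this.exists
    exact ⟨m, trivial, hm⟩
  let y' : L → G ⧸ H → BddSeq A := fun l x =>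
    bddSeqOf (fun n => y l x (m n)) ‖y l x‖ fun n => norm_bddSeq_apply_le _ _
  refine ⟨fun l x => cls (star (y' l x) * y' l x), fun l x => ?_, ?_⟩
  · change 0 ≤ cls (star (y' l x) * y' l x)
    rw [map_mul, map_star]
    exact star_mul_self_nonneg _
  · refine hZd.trans ((isClosed_setOf_isTower _ _ _).closure_subset_iff.2 fun z hz => ?_)
    refine isTower_iff.2 fun r => ?_
    have h3 := hm (⟨z, hz⟩, r)
    rw [← show cls (ζ ⟨z, hz⟩) = z from hζ ⟨z, hz⟩,
      ← map_towerDefect (cls (A := A)) (act := fun g => bddSeqMap (α g)) (fun g r => rfl),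
      cls_eq_zero_iff]
    refine h3.congr fun n => ?_
    exact (map_towerDefect (evalSeq (A := A) n) (act := fun g => bddSeqMap (α g))
      (act' := fun g => α g) (fun g r => rfl) c (fun l x => star (y' l x) * y' l x) (ζ ⟨z, hz⟩) r).symm

/-- Finitely generated groups are countable. -/
theorem countable_of_group_fg (G : Type*) [Group G] [Group.FG G] : Countable G := by
  obtain ⟨n, _, f, hf⟩ := Group.fg_iff_exists_freeGroup_hom_surjective_finite.1 ‹Group.FG G›
  exact hf.countable

end Towers

/-! ### Quasicentral, almost invariant approximate units -/

section Quasicentral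

open TopologicalSpace

/-- Averages of elements with almost orthogonal images have small images. -/
theorem exists_mem_norm_lt_of_convex {J A κ : Type*} [AddCommGroup J] [Module ℝ J]
    [NonUnitalCStarAlgebra A] [Finite κ] {K : Set J} (hK : Convex ℝ K) {l : Filter J} [l.NeBot]
    (hl : ∀ᶠ e in l, e ∈ K) (T : κ → J →ₗ[ℝ] A) (hC : ∀ k, ∃ C, ∀ e ∈ K, ‖T k e‖ ≤ C)
    (hT : ∀ k, ∀ c, Tendsto (fun e => star (T k c) * T k e) l (𝓝 0)) {ε : ℝ} (hε : 0 < ε) :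
    ∃ e ∈ K, ∀ k, ‖T k e‖ < ε := by
  classical
  choose C hC using hC
  -- The average of N terms will satisfy ‖T‖² ≤ C²/N + δ, which is below 2δ = ε² for large N.
  set δ : ℝ := ε ^ 2 / 2 with hδ
  have hδ0 : 0 < δ := by positivity
  -- Each new term is chosen almost orthogonal, under every `T k`, to all earlier ones.
  obtain ⟨e, heK, he⟩ := exists_seq_of_forall_finset_exists (fun e => e ∈ K)
    (fun x y => ∀ k, ‖star (T k x) * T k y‖ < δ) fun s _ => by
      have h1 : ∀ᶠ y in l, ∀ x ∈ s, ∀ k, ‖star (T k x) * T k y‖ < δ := by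
        refine (Filter.eventually_all_finset s).2 fun x _ => eventually_all.2 fun k => ?_
        have := (hT k x).norm
        rw [norm_zero] at this
        exact this.eventually (gt_mem_nhds hδ0)
      exact (hl.and h1).exists
  -- Almost Pythagoras: adding a term contributes its own square and two cross terms of norm at most
  -- Nδ, and N² + 2N ≤ (N + 1)².
  have hS : ∀ k (N : ℕ), ‖∑ i ∈ Finset.range N, T k (e i)‖ ^ 2 ≤ N * C k ^ 2 + N ^ 2 * δ := by
    intro k N
    induction N with
    | zero => simp
    | succ N ih =>
      rw [Finset.sum_range_succ]
      set S := ∑ i ∈ Finset.range N, T k (e i) with hSdef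
      set x := T k (e N)
      have h1 : ‖star S * x‖ ≤ N * δ := by
        rw [hSdef, star_sum, Finset.sum_mul]
        refine (norm_sum_le _ _).trans ?_
        calc _ ≤ ∑ i ∈ Finset.range N, δ :=
              Finset.sum_le_sum fun i hi => (he i N (Finset.mem_range.1 hi) k).le
          _ = N * δ := by simp
      have h2 : ‖star x * S‖ ≤ N * δ := by
        rw [← norm_star, star_mul, star_star]
        exact h1
      have h3 : ‖x‖ ^ 2 ≤ C k ^ 2 := by
        gcongr
        exact hC k _ (heK N)
      calc ‖S + x‖ ^ 2 = ‖star (S + x) * (S + x)‖ := by rw [CStarRing.norm_star_mul_self, sq]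
        _ = ‖star S * S + star S * x + star x * S + star x * x‖ := by
          congr 1
          rw [star_add]
          noncomm_ring
        _ ≤ ‖star S * S‖ + ‖star S * x‖ + ‖star x * S‖ + ‖star x * x‖ := norm_add₄_le
        _ = ‖S‖ ^ 2 + ‖star S * x‖ + ‖star x * S‖ + ‖x‖ ^ 2 := by
          rw [CStarRing.norm_star_mul_self, CStarRing.norm_star_mul_self, sq, sq]
        _ ≤ (N * C k ^ 2 + N ^ 2 * δ) + N * δ + N * δ + C k ^ 2 := by gcongr
        _ ≤ _ := by push_cast; nlinarith
  have hN : ∀ᶠ N : ℕ in atTop, ∀ k, C k ^ 2 / N < δ :=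
    eventually_all.2 fun k => (tendsto_const_div_atTop_nhds_zero_nat _).eventually (gt_mem_nhds hδ0)
  obtain ⟨N, hN, hN0⟩ := (hN.and (eventually_gt_atTop 0)).exists
  have hN0' : (0 : ℝ) < N := by exact_mod_cast hN0
  refine ⟨∑ i ∈ Finset.range N, (1 / N : ℝ) • e i, hK.sum_mem (fun _ _ => by positivity)
    (by simp [hN0.ne']) (fun i _ => heK i), fun k => ?_⟩
  rw [← Finset.smul_sum, map_smul, map_sum, norm_smul]
  refine lt_of_pow_lt_pow_left₀ 2 hε.le ?_
  rw [mul_pow]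
  calc ‖(1 / N : ℝ)‖ ^ 2 * ‖∑ i ∈ Finset.range N, T k (e i)‖ ^ 2
      ≤ ‖(1 / N : ℝ)‖ ^ 2 * (N * C k ^ 2 + N ^ 2 * δ) := by gcongr; exact hS k N
    _ = C k ^ 2 / N + δ := by
      rw [Real.norm_of_nonneg (by positivity)]
      field_simp
    _ < δ + δ := by gcongr; exact hN k
    _ = ε ^ 2 := by rw [hδ]; ring

variable {G J A : Type*} [Group G] [NonUnitalCStarAlgebra J] [NonUnitalCStarAlgebra A]

/-- Positivity, the norm bound and being almost a unit on T are convex conditions, eventually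
satisfied by an approximate unit, so they survive averaging. Commutators with S and the differences
under M are linear in e, and averaging makes them small. The form y*y makes positivity pass to
sequences. -/
theorem exists_quasicentral (α : G →* (J ≃⋆ₐ[ℂ] J)) (ι : J →⋆ₙₐ[ℂ] A)
    (hl : ∀ a j, ∃ j', ι j' = a * ι j) (hr : ∀ a j, ∃ j', ι j' = ι j * a)
    (T : Finset J) (S : Finset A) (M : Finset G) {δ : ℝ} (hδ : 0 < δ) :
    ∃ y : J, ‖y‖ ≤ 1 ∧ (∀ t ∈ T, ‖t - t * (star y * y)‖ < δ) ∧
      (∀ s ∈ S, ‖ι (star y * y) * s - s * ι (star y * y)‖ < δ) ∧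
      ∀ g ∈ M, ‖ι (α g (star y * y) - star y * y)‖ < δ := by
  let _ : PartialOrder J := CStarAlgebra.spectralOrder J
  have _ : StarOrderedRing J := CStarAlgebra.spectralOrderedRing J
  have hu := CStarAlgebra.increasingApproximateUnit J
  set l := CStarAlgebra.approximateUnit J
  have hmul : ∀ t : J, Tendsto (fun e => t * e) l (𝓝 t) := hu.tendsto_mul_left
  let K : Set J := {e | 0 ≤ e} ∩ (Metric.closedBall 0 1 ∩ ⋂ t ∈ T, {e | ‖t - t * e‖ < δ})
  have hK : Convex ℝ K := by
    refine Convex.inter ?_ (Convex.inter (convex_closedBall _ _) (convex_iInter₂ fun t _ => ?_))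
    · intro x hx y hy a b ha hb _
      have hx' : 0 ≤ x := hx
      have hy' : 0 ≤ y := hy
      exact add_nonneg (smul_nonneg ha hx') (smul_nonneg hb hy')
    · intro x hx y hy a b ha hb hab
      have h1 : t - t * (a • x + b • y) = a • (t - t * x) + b • (t - t * y) := by
        rw [mul_add, mul_smul_comm, mul_smul_comm, smul_sub, smul_sub]
        nth_rewrite 1 [← one_smul ℝ t, ← hab, add_smul]
        abel
      change ‖t - t * (a • x + b • y)‖ < δ
      rw [h1]
      have h2 := (convex_ball (0 : J) δ) (x := t - t * x) (by simpa using hx) (y := t - t * y)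
        (by simpa using hy) ha hb hab
      simpa using h2
  have hKl : ∀ᶠ e in l, e ∈ K := by
    refine (hu.eventually_nonneg).and ((hu.eventually_norm.mono fun e he => by simpa using he).and ?_)
    have : ∀ᶠ e in l, ∀ t ∈ T, ‖t - t * e‖ < δ := by
      refine (Filter.eventually_all_finset T).2 fun t _ => ?_
      have := (tendsto_const_nhds (x := t)).sub (hmul t)
      rw [sub_self] at this
      have := this.norm
      rw [norm_zero] at this
      exact this.eventually (gt_mem_nhds hδ)
    filter_upwards [this] with e he
    exact Set.mem_iInter₂.2 he
  let ιₗ : J →ₗ[ℝ] A := (ι : J →ₗ[ℂ] A).restrictScalars ℝ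
  let Φ : S ⊕ M → J →ₗ[ℝ] A
    | .inl s => (LinearMap.mulRight ℝ (s : A) - LinearMap.mulLeft ℝ (s : A)) ∘ₗ ιₗ
    | .inr g => ιₗ ∘ₗ ((((α g : J →⋆ₙₐ[ℂ] J) : J →ₗ[ℂ] J)).restrictScalars ℝ - LinearMap.id)
  have hΦl : ∀ s e, Φ (.inl s) e = ι e * s - s * ι e := fun s e => rfl
  have hΦr : ∀ g e, Φ (.inr g) e = ι (α g e - e) := fun g e => rfl
  have hι := continuous_starHom ι
  obtain ⟨e, ⟨he0, he1, heT⟩, he⟩ := exists_mem_norm_lt_of_convex hK hKl Φ (by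
    rintro (s | g)
    · refine ⟨1 * ‖(s : A)‖ + ‖(s : A)‖ * 1, fun e he => ?_⟩
      have h1 : ‖ι e‖ ≤ 1 := (NonUnitalStarAlgHom.norm_apply_le ι e).trans (by simpa using he.2.1)
      rw [hΦl]
      refine (norm_sub_le _ _).trans (add_le_add ((norm_mul_le _ _).trans ?_)
        ((norm_mul_le _ _).trans ?_)) <;> gcongr
    · refine ⟨1 + 1, fun e he => ?_⟩
      have h1 : ‖e‖ ≤ 1 := by simpa using he.2.1
      rw [hΦr]
      refine (NonUnitalStarAlgHom.norm_apply_le ι _).trans ((norm_sub_le _ _).trans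
        (add_le_add ?_ h1))
      exact (NonUnitalStarAlgHom.norm_apply_le (α g) e).trans h1) (by
    rintro (s | g) c
    -- The adjoint of a commutator with ι(c) lies in the ideal, say it is ι(c₁). Both ι(c₁ e)s and
    -- ι(c₁)s ι(e) tend to ι(c₁)s, so the product with the commutator of ι(e) tends to 0.
    · obtain ⟨c₁, hc₁⟩ : ∃ c₁, ι c₁ = star (Φ (.inl s) c) := by
        obtain ⟨j₁, h₁⟩ := hl (star s) (star c)
        obtain ⟨j₂, h₂⟩ := hr (star s) (star c)
        refine ⟨j₁ - j₂, ?_⟩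
        rw [hΦl, map_sub, h₁, h₂, star_sub, star_mul, star_mul, map_star]
      obtain ⟨c₂, hc₂⟩ := hr s c₁
      have h := ((hι.tendsto _).comp (hmul c₁)).mul_const (s : A)
      have h' := (hι.tendsto _).comp (hmul c₂)
      have h3 := h.sub h'
      rw [hc₂, sub_self] at h3
      refine h3.congr fun e => ?_
      rw [← hc₁, hΦl, mul_sub, ← mul_assoc, ← mul_assoc, ← hc₂, ← map_mul, ← map_mul]
      rfl
    · have hα : Continuous (α g) := (StarAlgEquiv.isometry (α g)).continuous
      set c' := star (α g c - c)
      -- Since c'α_g(e) = α_g(α_{g⁻¹}(c')e) tends to c', as does c'e, the product c'(α_g(e) - e)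
      -- tends to 0.
      have h := (hα.tendsto _).comp (hmul (α (g : G)⁻¹ c'))
      have hg : ∀ x, α g (α (g : G)⁻¹ x) = x := fun x => by
        rw [← StarAlgEquiv.mul_apply, ← map_mul, mul_inv_cancel, map_one, StarAlgEquiv.one_apply]
      have h3 := (hι.tendsto _).comp (h.sub (hmul c'))
      rw [hg, sub_self, map_zero] at h3
      refine h3.congr fun e => ?_
      rw [hΦr, hΦr, ← map_star, ← map_mul]
      simp only [Function.comp_apply, map_mul, hg]
      rw [← mul_sub, map_mul]) hδ
  have hy : e = star (CFC.sqrt e) * CFC.sqrt e := by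
    rw [(IsSelfAdjoint.of_nonneg (CFC.sqrt_nonneg e)).star_eq, CFC.sqrt_mul_sqrt_self e he0]
  refine ⟨CFC.sqrt e, ?_, ?_⟩
  · have h1 : ‖CFC.sqrt e‖ * ‖CFC.sqrt e‖ ≤ 1 := by
      rw [← CStarRing.norm_star_mul_self, ← hy]
      simpa using he1
    nlinarith [norm_nonneg (CFC.sqrt e)]
  · rw [← hy]
    exact ⟨fun t ht => Set.mem_iInter₂.1 heT t ht, fun s hs => he (.inl ⟨s, hs⟩),
      fun g hg => he (.inr ⟨g, hg⟩)⟩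

/-- Ideals have quasicentral invariant units for separable sets in the sequence algebra. -/
theorem exists_quasicentral_inf [Countable G] (α : G →* (J ≃⋆ₐ[ℂ] J)) (ι : J →⋆ₙₐ[ℂ] A)
    (hι : Function.Injective ι) (hl : ∀ a j, ∃ j', ι j' = a * ι j)
    (hr : ∀ a j, ∃ j', ι j' = ι j * a) {T : Set (AInf J)} (hT : IsSeparable T)
    {S : Set (AInf A)} (hS : IsSeparable S) :
    ∃ e : AInf J, 0 ≤ e ∧ ‖e‖ ≤ 1 ∧ (∀ t ∈ T, t * e = t) ∧
      (∀ s ∈ S, infMap ι e * s = s * infMap ι e) ∧ ∀ g, aInfMap (α g) e = e := by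
  classical
  obtain ⟨T₀, -, hTc, hTd⟩ := hT.exists_countable_dense_subset
  obtain ⟨S₀, -, hSc, hSd⟩ := hS.exists_countable_dense_subset
  have := hTc.to_subtype
  have := hSc.to_subtype
  choose τ hτ using fun z : T₀ => cls_surjective (z : AInf J)
  choose σ hσ using fun z : S₀ => cls_surjective (z : AInf A)
  -- The first condition is pushed through ι, isometrically, so that all three take values in A.
  let v : T₀ ⊕ S₀ ⊕ G → ℕ → J → A := fun i n y => match i with
    | .inl t => ι (τ t n - τ t n * (star y * y))
    | .inr (.inl s) => ι (star y * y) * σ s n - σ s n * ι (star y * y)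
    | .inr (.inr g) => ι (α g (star y * y) - star y * y)
  obtain ⟨y, hy1, hy⟩ := exists_diagonal_seq (fun y : J => ‖y‖ ≤ 1) v fun s n δ hδ => by
    obtain ⟨y, hy1, h1, h2, h3⟩ := exists_quasicentral α ι hl hr
      (s.toLeft.image fun t => τ t n) (s.toRight.toLeft.image fun t => σ t n) s.toRight.toRight hδ
    refine ⟨y, hy1, ?_⟩
    rintro (t | t | g) h
    · change ‖ι _‖ < δ
      rw [NonUnitalStarAlgHom.norm_map ι hι]
      exact h1 _ (Finset.mem_image_of_mem _ (by simpa using h))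
    · exact h2 _ (Finset.mem_image_of_mem _ (by simpa using h))
    · exact h3 _ (by simpa using h)
  let Y : BddSeq J := bddSeqOf y 1 hy1
  have hY : ‖cls Y‖ ≤ 1 := by
    refine (NonUnitalStarAlgHom.norm_apply_le cls Y).trans ?_
    exact lp.norm_le_of_forall_le zero_le_one hy1
  refine ⟨cls (star Y * Y), ?_, ?_, ?_, ?_, fun g => ?_⟩
  · rw [map_mul, map_star]
    exact star_mul_self_nonneg _
  · rw [map_mul, map_star, CStarRing.norm_star_mul_self]
    nlinarith [norm_nonneg (cls Y)]
  · have hcl : IsClosed {t : AInf J | t * cls (star Y * Y) = t} :=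
      isClosed_eq (by fun_prop) (by fun_prop)
    refine hTd.trans (hcl.closure_subset_iff.2 fun t ht => ?_)
    have h := hy (.inl ⟨t, ht⟩)
    have h2 : cls (τ ⟨t, ht⟩ - τ ⟨t, ht⟩ * (star Y * Y)) = 0 := by
      refine infMap_injective hι ?_
      rw [map_zero, infMap_cls, cls_eq_zero_iff]
      exact h
    rw [map_sub, map_mul, hτ, sub_eq_zero] at h2
    exact h2.symm
  · have hcl : IsClosed {s : AInf A | infMap ι (cls (star Y * Y)) * s =
        s * infMap ι (cls (star Y * Y))} := isClosed_eq (by fun_prop) (by fun_prop)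
    refine hSd.trans (hcl.closure_subset_iff.2 fun s hs => ?_)
    have h := hy (.inr (.inl ⟨s, hs⟩))
    have h2 : cls (seqMap ι (star Y * Y) * σ ⟨s, hs⟩ - σ ⟨s, hs⟩ * seqMap ι (star Y * Y)) = 0 :=
      cls_eq_zero_iff.2 h
    rw [map_sub cls, map_mul cls (seqMap ι _), map_mul cls (σ _), hσ, sub_eq_zero] at h2
    exact h2
  · have h := hy (.inr (.inr g))
    refine infMap_injective hι (sub_eq_zero.1 ?_)
    rw [← map_sub, aInfMap_cls, ← map_sub, infMap_cls, cls_eq_zero_iff]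
    exact h

end Quasicentral

/-! ### Towers for extensions -/

section Extension

open TopologicalSpace

theorem mul_left_comm_of_commute {R : Type*} [NonUnitalRing R] {x e : R} (h : e * x = x * e)
    (w : R) : x * (e * w) = e * (x * w) := by
  rw [← mul_assoc, ← h, mul_assoc]

/-- `a - e * a` is positive for commuting `0 ≤ a` and `0 ≤ e ≤ 1`. -/
theorem sub_mul_nonneg_of_commute {R : Type*} [NonUnitalCStarAlgebra R] [PartialOrder R]
    [StarOrderedRing R] {e a : R} (he : 0 ≤ e) (he1 : ‖e‖ ≤ 1) (ha : 0 ≤ a) (h : e * a = a * e) :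
    0 ≤ a - e * a := by
  -- Commutation gives ea = √a e √a ≤ ‖e‖ a ≤ a.
  have h1 : Commute (CFC.sqrt a) e := Commute.cfcₙ_nnreal (show Commute a e from h.symm) _
  have hs : IsSelfAdjoint (CFC.sqrt a) := IsSelfAdjoint.of_nonneg (CFC.sqrt_nonneg a)
  have h2 := CStarAlgebra.star_left_conjugate_le_norm_smul (a := CFC.sqrt a) (b := e)
    (IsSelfAdjoint.of_nonneg he)
  rw [hs.star_eq, CFC.sqrt_mul_sqrt_self a ha, h1.eq, mul_assoc, CFC.sqrt_mul_sqrt_self a ha] at h2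
  refine sub_nonneg.2 (h2.trans ?_)
  calc ‖e‖ • a ≤ (1 : ℝ) • a := by gcongr
    _ = a := one_smul _ _

/-- Gluing towers along an invariant central element. -/
theorem isTower_glue {G X L₁ L₂ R : Type*} [Group G] [MulAction G X] [Fintype X] [Fintype L₁]
    [Fintype L₂] [NonUnitalRing R] {act : G → R →ₙ+* R} {c : Prop} {e : R}
    {a : L₁ → X → R} {b : L₂ → X → R} {z : R} (hge : ∀ g, act g e = e)
    (ha : IsTower (fun g => act g) c a e) (haz : IsTower (fun g => act g) c a (e * z))
    (habz : ∀ l x k y, a l x * (e * (b k y * z)) = e * (b k y * z) * a l x)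
    (hez : e * z = z * e) (heb : ∀ l x, e * b l x = b l x * e)
    (hbz : ∀ r, e * towerDefect (fun g => act g) c b z r = towerDefect (fun g => act g) c b z r) :
    IsTower (fun g => act g) c
      (Sum.elim (fun l x => e * a l x) (fun l x => b l x - e * b l x)) z := by
  -- The identities up to `hab` allow all factors e to be moved to the left; `hab` says that the two
  -- kinds of towers commute once multiplied by e and z.
  have hea : ∀ l x, e * a l x = a l x * e := fun l x => (ha.comm l x).symm
  have hega : ∀ g l x, e * act g (a l x) = act g (a l x) * e := fun g l x => by
    have := congrArg (act g) (hea l x)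
    rwa [map_mul, map_mul, hge] at this
  have hea' := fun l x => mul_left_comm_of_commute (hea l x)
  have heb' := fun l x => mul_left_comm_of_commute (heb l x)
  have hega' := fun g l x => mul_left_comm_of_commute (hega g l x)
  have hez' := mul_left_comm_of_commute hez
  have hza : ∀ l x, e * (z * a l x) = e * (a l x * z) := fun l x => by
    have := haz.comm l x
    rw [hea', mul_assoc] at this
    exact this.symm
  have hbza : ∀ l x k y, e * (b k y * (z * a l x)) = e * (a l x * (b k y * z)) := fun l x k y => by
    have := habz l x k y
    rw [hea', mul_assoc, mul_assoc] at this
    exact this.symm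
  have hab : ∀ l x k y, e * (a l x * (b k y * z)) = e * (b k y * (a l x * z)) := fun l x k y => by
    rw [← hbza, ← heb', hza, heb']
  refine ⟨?_, ?_, ?_, ?_, ?_⟩
  · rintro (l | l) x
    · simp only [Sum.elim_inl, mul_assoc, hez']
      exact (hza l x).symm
    · have h := hbz (.comm l x)
      simp only [towerDefect, mul_sub] at h
      simp only [Sum.elim_inr, mul_sub, sub_mul, mul_assoc, hez']
      rw [sub_eq_sub_iff_sub_eq_sub] at h ⊢
      rw [sub_eq_sub_iff_add_eq_add] at h ⊢
      rw [add_comm, ← h, add_comm]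
  · rintro (l | l) x y hxy
    · have h := haz.orth l x y hxy
      simp only [mul_assoc, hea'] at h
      simp only [Sum.elim_inl, mul_assoc, hea', h, mul_zero]
    · have h := hbz (.orth l x y)
      simp only [towerDefect, hxy, if_false, mul_assoc] at h
      simp only [Sum.elim_inr, mul_sub, sub_mul, mul_assoc, heb', h]
      abel
  · rintro g (l | l) x
    · have h := haz.equiv g l x
      simp only [sub_mul, hega', hea'] at h
      simp only [Sum.elim_inl, map_mul, hge, sub_mul, mul_assoc]
      exact h
    · have h := hbz (.equiv g l x)
      simp only [towerDefect, mul_sub, sub_mul] at h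
      simp only [Sum.elim_inr, map_sub, map_mul, hge, sub_mul, mul_assoc]
      rw [sub_sub_sub_comm, ← h, sub_self]
  -- The sum of the ea over z is ez. Since e fixes Σbz - z, the sum of the (1 - e)b over z is (1 -
  -- e)z.
  · have h := haz.sum
    have h' := hbz .sum
    simp only [towerDefect, mul_sub] at h'
    simp only [Finset.sum_mul, hea'] at h
    simp only [Fintype.sum_sum_type, Sum.elim_inl, Sum.elim_inr, Finset.sum_sub_distrib, add_mul,
      sub_mul, ← Finset.mul_sum]
    simp only [Finset.mul_sum, Finset.sum_mul, mul_assoc] at h h' ⊢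
    rw [h]
    rw [sub_eq_sub_iff_sub_eq_sub] at h'
    rw [← neg_sub, h']
    abel
  · rintro hc (l | l) x (k | k) y hlk
    · have h := haz.towers hc l x k y (by simpa using hlk)
      simp only [sub_mul, mul_assoc, hea'] at h
      simp only [Sum.elim_inl, sub_mul, mul_assoc, hea']
      rw [← mul_sub, h, mul_zero]
    · simp only [Sum.elim_inl, Sum.elim_inr, mul_sub, sub_mul, mul_assoc, hea', heb', hab, sub_self]
    · simp only [Sum.elim_inl, Sum.elim_inr, mul_sub, sub_mul, mul_assoc, hea', heb', hab, sub_self]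
    · have h := hbz (.towers l x k y)
      have hlk' : l ≠ k := by simpa using hlk
      simp only [towerDefect, hc, hlk', ne_eq, not_false_eq_true, and_self, if_true,
        sub_mul, mul_assoc] at h
      simp only [Sum.elim_inr, mul_sub, sub_mul, mul_assoc, heb']
      set t := b l x * (b k y * z) - b k y * (b l x * z) with ht
      -- The commutator of two towers (1 - e)b, times z, is (1 - e)²t, and et = t.
      calc _ = t - e * t - (e * t - e * (e * t)) := by
            rw [ht]
            simp only [mul_sub]
            abel
        _ = 0 := by simp only [h, sub_self]

/-- The direct sum of the index sets works for extensions. -/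
theorem HasTowers.extension {G J A B L₁ L₂ : Type*} [Group G] [Countable G]
    [NonUnitalCStarAlgebra J] [NonUnitalCStarAlgebra A] [NonUnitalCStarAlgebra B] [Fintype L₁]
    [Fintype L₂] {α : G →* (J ≃⋆ₐ[ℂ] J)} {β : G →* (A ≃⋆ₐ[ℂ] A)} {γ : G →* (B ≃⋆ₐ[ℂ] B)}
    {ι : J →⋆ₙₐ[ℂ] A} {π : A →⋆ₙₐ[ℂ] B} (hext : IsEquivariantExtension α β γ ι π)
    {H : Subgroup G} [H.FiniteIndex] {c : Prop} (hα : HasTowers α H L₁ c)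
    (hγ : HasTowers γ H L₂ c) : HasTowers β H (L₁ ⊕ L₂) c := by
  intro Z hZ
  have hinj := infMap_injective hext.injective
  have hex := infMap_exact hext.injective hext.exact hext.surjective
  have hsurj := infMap_surjective hext.surjective
  have hιβ : ∀ g j, infMap ι (aInfMap (α g) j) = aInfMap (β g) (infMap ι j) := fun g j => by
    obtain ⟨j, rfl⟩ := cls_surjective j
    rw [aInfMap_cls, infMap_cls, infMap_cls, aInfMap_cls]
    congr 1
    ext n
    exact hext.equivariant_left g (j n)
  have hπγ : ∀ g x, infMap π (aInfMap (β g) x) = aInfMap (γ g) (infMap π x) := fun g x => by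
    obtain ⟨x, rfl⟩ := cls_surjective x
    rw [aInfMap_cls, infMap_cls, infMap_cls, aInfMap_cls]
    congr 1
    ext n
    exact hext.equivariant_right g (x n)
  have hl : ∀ a j, ∃ j', ι j' = a * ι j := fun a j =>
    (hext.exact _).1 (by rw [map_mul, hext.exact.apply_apply_eq_zero, mul_zero])
  have hr : ∀ a j, ∃ j', ι j' = ι j * a := fun a j =>
    (hext.exact _).1 (by rw [map_mul, hext.exact.apply_apply_eq_zero, zero_mul])
  obtain ⟨b₀, hb₀, hb₀Z⟩ := hγ (infMap π '' Z) (hZ.image (continuous_starHom _))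
  choose b hb hbb₀ using fun l x => exists_nonneg_lift hsurj (hb₀ l x)
  -- The translates of b are included so that the equivariance defects also lie in C.
  let W : Set (AInf A) := Z ∪ (Set.range (fun p : L₂ × G ⧸ H => b p.1 p.2) ∪
    Set.range fun p : G × L₂ × G ⧸ H => aInfMap (β p.1) (b p.2.1 p.2.2))
  have hW : IsSeparable W := hZ.union ((Set.countable_range _).isSeparable.union
    (Set.countable_range _).isSeparable)
  let C := NonUnitalStarAlgebra.adjoin ℂ W
  have hC : IsSeparable (C : Set (AInf A)) := isSeparable_adjoin hW
  have hWC : W ⊆ C := NonUnitalStarAlgebra.subset_adjoin ℂ W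
  have hZC : ∀ z ∈ Z, z ∈ C := fun z hz => hWC (Or.inl hz)
  have hbC : ∀ l x, b l x ∈ C := fun l x => hWC (Or.inr (Or.inl ⟨(l, x), rfl⟩))
  have hgbC : ∀ g l x, aInfMap (β g) (b l x) ∈ C := fun g l x =>
    hWC (Or.inr (Or.inr ⟨(g, l, x), rfl⟩))
  have hind := (NonUnitalStarAlgHom.isometry (infMap ι) hinj).isUniformInducing.isInducing
  obtain ⟨e₀, he0, he1, heT, heC, heg⟩ := exists_quasicentral_inf α ι hext.injective hl hr
    (hind.isSeparable_preimage hC) hC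
  set e := infMap ι e₀ with he
  have heker : ∀ s ∈ C, infMap π s = 0 → e * s = s := fun s hs hs0 => by
    obtain ⟨j, rfl⟩ := (hex s).1 hs0
    rw [heC _ hs, he, ← map_mul, heT j hs]
  -- The towers in J_∞ are chosen after e, so that they can be adapted to e and to eC, which lies in
  -- the ideal.
  have hZα : IsSeparable (infMap ι ⁻¹' ({e} ∪ (fun s => e * s) '' (C : Set (AInf A)))) :=
    hind.isSeparable_preimage ((Set.countable_singleton e).isSeparable.union
      (hC.image (continuous_const_mul e)))
  obtain ⟨a₀, ha₀, ha₀Z⟩ := hα _ hZα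
  have hae : IsTower (fun g => aInfMap (β g)) c (fun l x => infMap ι (a₀ l x)) e :=
    (ha₀Z e₀ (Or.inl rfl)).map (infMap ι) hιβ
  have has : ∀ s ∈ C, IsTower (fun g => aInfMap (β g)) c (fun l x => infMap ι (a₀ l x)) (e * s) :=
    fun s hs => by
      obtain ⟨j, hj⟩ : ∃ j, infMap ι j = e * s :=
        (hex _).1 (by rw [map_mul, he, hex.apply_apply_eq_zero, zero_mul])
      rw [← hj]
      exact (ha₀Z j (Or.inr ⟨s, hs, hj.symm⟩)).map (infMap ι) hιβ
  have hnn : ∀ l x, 0 ≤ infMap ι (a₀ l x) := fun l x => by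
    obtain ⟨y, hy⟩ := CStarAlgebra.nonneg_iff_eq_star_mul_self.1 (ha₀ l x)
    rw [hy, map_mul, map_star]
    exact star_mul_self_nonneg _
  have hen : 0 ≤ e := by
    obtain ⟨y, hy⟩ := CStarAlgebra.nonneg_iff_eq_star_mul_self.1 he0
    rw [he, hy, map_mul, map_star]
    exact star_mul_self_nonneg _
  have hen1 : ‖e‖ ≤ 1 := (NonUnitalStarAlgHom.norm_apply_le _ _).trans he1
  refine ⟨Sum.elim (fun l x => e * infMap ι (a₀ l x)) (fun l x => b l x - e * b l x), ?_, ?_⟩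
  · rintro (l | l) x
    · exact Commute.mul_nonneg hen (hnn l x) (hae.comm l x).symm
    · exact sub_mul_nonneg_of_commute hen hen1 (hb l x) (heC _ (hbC l x))
  · intro z hz
    have hzC := hZC z hz
    refine isTower_glue (act := fun g => (aInfMap (β g) : AInf A →ₙ+* AInf A))
      (fun g => ?_) hae (has z hzC) (fun l x k y => (has _ (mul_mem (hbC k y) hzC)).comm l x)
      (heC z hzC) (fun l x => heC _ (hbC l x)) fun r => heker _ ?_ ?_
    · change aInfMap (β g) e = e
      rw [he, ← hιβ, heg]
    -- Every defect of b over z lies in C; π_∞ kills it because its image is a defect of the towers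
    -- in B_∞. By `heker`, e therefore fixes it.
    · cases r <;> simp only [towerDefect] <;> try split_ifs
      · exact sub_mem (mul_mem (hbC _ _) hzC) (mul_mem hzC (hbC _ _))
      · exact zero_mem _
      · exact mul_mem (mul_mem (hbC _ _) (hbC _ _)) hzC
      · exact mul_mem (sub_mem (hgbC _ _ _) (hbC _ _)) hzC
      · exact sub_mem (mul_mem (sum_mem fun l _ => sum_mem fun x _ => hbC l x) hzC) hzC
      · exact mul_mem (sub_mem (mul_mem (hbC _ _) (hbC _ _)) (mul_mem (hbC _ _) (hbC _ _))) hzC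
      · exact zero_mem _
    · have h := isTower_iff.1 (hb₀Z _ ⟨z, hz, rfl⟩) r
      rw [← h]
      refine (map_towerDefect (infMap π) (act' := fun g => aInfMap (γ g)) hπγ c b z r).trans ?_
      simp only [hbb₀]

end Extension

/-! ### Order zero maps on finite-dimensional commutative C*-algebras -/

section OrderZero

theorem exists_eq_star_mul_self {C : Type*} [NonUnitalCStarAlgebra C] [PartialOrder C]
    [StarOrderedRing C] {a : C} (ha : 0 ≤ a) : ∃ b, a = star b * b :=
  CStarAlgebra.nonneg_iff_eq_star_mul_self.1 ha

theorem IsUnitOf.norm_le_one {F : Type*} [NonUnitalCStarAlgebra F] {u : F} (hu : IsUnitOf u) :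
    ‖u‖ ≤ 1 := by
  have h : ‖u‖ * ‖u‖ = ‖u‖ := by
    rw [← CStarRing.norm_star_mul_self, (hu (star u)).2, norm_star]
  nlinarith [norm_nonneg u]

theorem sum_smul_mul_sum_smul {X F : Type*} [Fintype X] [NonUnitalCStarAlgebra F] {p : X → F}
    (ho : ∀ x y, x ≠ y → p x * p y = 0) (f g : X → ℂ) :
    (∑ x, f x • p x) * (∑ x, g x • p x) = ∑ x, (f x * g x) • (p x * p x) := by
  rw [Finset.sum_mul]
  refine Finset.sum_congr rfl fun x _ => ?_
  rw [Finset.mul_sum, Finset.sum_eq_single x, smul_mul_smul_comm]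
  · intro y _ hy
    rw [smul_mul_smul_comm, ho x y hy.symm, smul_zero]
  · simp

variable {X : Type u} {F : Type v} [Fintype X] [NonUnitalCStarAlgebra F] [PartialOrder F]
  [StarOrderedRing F]

/-- The completely positive map sending the point mass at `x` to `p x`. -/
def cpOfNonneg (p : X → F) (hp : ∀ x, 0 ≤ p x) : CompletelyPositiveMap (X → ℂ) F where
  toFun f := ∑ x, f x • p x
  map_add' f g := by simp only [Pi.add_apply, add_smul, Finset.sum_add_distrib]
  map_smul' c f := by
    simp only [Pi.smul_apply, smul_eq_mul, mul_smul, Finset.smul_sum, RingHom.id_apply]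
  map_cstarMatrix_nonneg' k M hM := by
    obtain ⟨N, rfl⟩ := exists_eq_star_mul_self hM
    -- If M = N*N, the image of M is the sum over x of P_x*P_x, where P_x is N(x) with entries
    -- multiplied by √p_x.
    let P : X → CStarMatrix (Fin k) (Fin k) F := fun x =>
      CStarMatrix.ofMatrix fun i j => N i j x • CFC.sqrt (p x)
    have hs : ∀ x, star (CFC.sqrt (p x)) * CFC.sqrt (p x) = p x := fun x => by
      rw [(IsSelfAdjoint.of_nonneg (CFC.sqrt_nonneg (p x))).star_eq,
        CFC.sqrt_mul_sqrt_self _ (hp x)]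
    have h : CStarMatrix.map (star N * N) (fun f : X → ℂ => ∑ x, f x • p x) =
        ∑ x, star (P x) * P x := by
      ext i j
      have h1 : ∀ (t : Finset X), (∑ x ∈ t, star (P x) * P x) i j =
          ∑ x ∈ t, (star (P x) * P x) i j := fun t => by
        classical
        induction t using Finset.induction_on with
        | empty => rfl
        | insert x t hx ih => rw [Finset.sum_insert hx, Finset.sum_insert hx, ← ih]; rfl
      rw [h1, CStarMatrix.map_apply]
      refine Finset.sum_congr rfl fun x _ => ?_
      rw [CStarMatrix.mul_apply, CStarMatrix.mul_apply, Finset.sum_apply, Finset.sum_smul]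
      refine Finset.sum_congr rfl fun m _ => ?_
      change (star (N m i x) * N m j x) • p x =
        star (N m i x • CFC.sqrt (p x)) * (N m j x • CFC.sqrt (p x))
      rw [star_smul, smul_mul_smul_comm, hs]
    change 0 ≤ CStarMatrix.map (star N * N) (fun f : X → ℂ => ∑ x, f x • p x)
    rw [h]
    exact Finset.sum_nonneg fun x _ => star_mul_self_nonneg (P x)

theorem cpOfNonneg_apply (p : X → F) (hp : ∀ x, 0 ≤ p x) (f : X → ℂ) :
    cpOfNonneg p hp f = ∑ x, f x • p x := rfl

theorem star_sum_smul {p : X → F} (hp : ∀ x, 0 ≤ p x) (f : X → ℂ) :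
    star (∑ x, f x • p x) = ∑ x, star f x • p x := by
  simp [star_sum, star_smul, (IsSelfAdjoint.of_nonneg (hp _)).star_eq]

/-- Orthogonality removes the cross terms: φ(f)φ(g) = Σ f(x)g(x)p_x², which vanishes if fg = 0, and
φ(f)*φ(f) ≤ ‖f‖²(Σ p_x)². -/
theorem cpOfNonneg_isContractiveOrderZero {p : X → F} (hp : ∀ x, 0 ≤ p x)
    (ho : ∀ x y, x ≠ y → p x * p y = 0) (h1 : ‖∑ x, p x‖ ≤ 1) :
    IsContractiveOrderZero (cpOfNonneg p hp) where
  contractive f := by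
    have hss : (∑ x, p x) * (∑ x, p x) = ∑ x, p x * p x := by
      simpa using sum_smul_mul_sum_smul ho 1 1
    have hpp : ∀ x, 0 ≤ p x * p x := fun x => by
      simpa [(IsSelfAdjoint.of_nonneg (hp x)).star_eq] using star_mul_self_nonneg (p x)
    have h2 : star (cpOfNonneg p hp f) * cpOfNonneg p hp f ≤
        (‖f‖ ^ 2 : ℝ) • ((∑ x, p x) * (∑ x, p x)) := by
      rw [cpOfNonneg_apply, star_sum_smul hp, sum_smul_mul_sum_smul ho, hss, Finset.smul_sum]
      refine Finset.sum_le_sum fun x _ => ?_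
      have h3 : star f x * f x = ((‖f x‖ ^ 2 : ℝ) : ℂ) := by
        rw [Pi.star_apply, RCLike.star_def, Complex.conj_mul', Complex.ofReal_pow]
      rw [h3, Complex.coe_smul]
      refine smul_le_smul_of_nonneg_right ?_ (hpp x)
      gcongr
      exact norm_le_pi_norm f x
    have h4 := CStarAlgebra.norm_le_norm_of_nonneg_of_le (star_mul_self_nonneg _) h2
    rw [CStarRing.norm_star_mul_self, norm_smul, Real.norm_of_nonneg (by positivity)] at h4
    have h5 : ‖(∑ x, p x) * (∑ x, p x)‖ ≤ 1 :=
      (norm_mul_le _ _).trans (mul_le_one₀ h1 (norm_nonneg _) h1)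
    have h6 : ‖cpOfNonneg p hp f‖ * ‖cpOfNonneg p hp f‖ ≤ ‖f‖ ^ 2 * 1 := h4.trans (by gcongr)
    nlinarith [norm_nonneg (cpOfNonneg p hp f), norm_nonneg f]
  orderZero f g hfg := by
    have key : ∀ f g : X → ℂ, f * g = 0 → (∑ x, f x • p x) * (∑ x, g x • p x) = 0 :=
      fun f g h => by
        rw [sum_smul_mul_sum_smul ho]
        refine Finset.sum_eq_zero fun x _ => ?_
        rw [show f x * g x = 0 from congrFun h x, zero_smul]
    simp only [Orth, cpOfNonneg_apply, star_sum_smul hp]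
    exact ⟨key _ _ hfg.1, key _ _ hfg.2.1, key _ _ hfg.2.2.1, key _ _ hfg.2.2.2⟩

end OrderZero

/-! ### Rokhlin families and towers -/

section Families

open TopologicalSpace

variable {G : Type v} [Group G] {A : Type u} [NonUnitalCStarAlgebra A]

/-- The existence of Rokhlin families, with commuting towers if `c` holds. -/
def HasFamilies (α : G →* (A ≃⋆ₐ[ℂ] A)) (H : Subgroup G) [H.FiniteIndex] (d : ℕ) (c : Prop) :
    Prop :=
  ∀ D : NonUnitalStarSubalgebra ℂ A, IsClosed (D : Set A) →
    IsSeparable (D : Set A) → ∀ hD : IsInvariant α D,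
      ∃ φ : Fin (d + 1) → CompletelyPositiveMap (CosetFun H) (centralSeq D),
        IsRokhlinFamily α H D hD φ ∧ (c → CommutingRanges fun l => ⇑(φ l))

/-- The quotient map onto the relative central sequence algebra. -/
def centralMk (D : NonUnitalStarSubalgebra ℂ A) : relComm D →⋆ₙₐ[ℂ] centralSeq D :=
  ClosedIdeal.Quotient.mk (ann D)

theorem centralMk_surjective (D : NonUnitalStarSubalgebra ℂ A) :
    Function.Surjective (centralMk D) := ClosedIdeal.Quotient.mkₗ_surjective

/-- Elements of the relative commutant annihilate D on one side exactly when they do on the other.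
-/
theorem centralMk_eq_iff {D : NonUnitalStarSubalgebra ℂ A} {x y : relComm D} :
    centralMk D x = centralMk D y ↔ ∀ d ∈ D, ((x : AInf A) - y) * toAInf d = 0 := by
  refine ClosedIdeal.Quotient.mkₗ_eq_iff.trans ⟨fun h d hd => (h d hd).1, fun h d hd => ?_⟩
  exact ⟨h d hd, ((x - y).2 d hd).symm.trans (h d hd)⟩

theorem centralAct_centralMk (α : G →* (A ≃⋆ₐ[ℂ] A)) (D : NonUnitalStarSubalgebra ℂ A)
    (hD : IsInvariant α D) (g : G) (x : relComm D) :
    centralAct α D hD g (centralMk D x) = centralMk D (relCommAct α D hD g x) := rfl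

/-- Towers over the constants of D lie in the relative commutant, and their other relations become
exact modulo the annihilator. Order zero maps are then prescribed on point masses. -/
theorem HasTowers.hasFamilies {α : G →* (A ≃⋆ₐ[ℂ] A)} {H : Subgroup G} [H.FiniteIndex] {d : ℕ}
    {c : Prop} (h : HasTowers α H (Fin (d + 1)) c) : HasFamilies α H d c := by
  intro D _ hDs hD
  obtain ⟨a, ha, haD⟩ := h (toAInf '' (D : Set A)) (hDs.image continuous_toAInf)
  replace haD : ∀ d ∈ D, IsTower (fun g => aInfMap (α g)) c a (toAInf d) :=
    fun d hd => haD _ ⟨d, hd, rfl⟩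
  let r : Fin (d + 1) → G ⧸ H → relComm D := fun l x => ⟨a l x, fun d hd => (haD d hd).comm l x⟩
  let p : Fin (d + 1) → G ⧸ H → centralSeq D := fun l x => centralMk D (r l x)
  have hp : ∀ l x, 0 ≤ p l x := fun l x => by
    -- The square root commutes with D too, so positivity is witnessed inside the relative commutant
    -- and passes to the quotient.
    let w : relComm D := ⟨CFC.sqrt (a l x), fun d hd =>
      Commute.cfcₙ_nnreal (show Commute (a l x) (toAInf d) from (haD d hd).comm l x) _⟩
    have hw : r l x = star w * w := by
      refine Subtype.ext ?_
      change a l x = star (CFC.sqrt (a l x)) * CFC.sqrt (a l x)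
      rw [(IsSelfAdjoint.of_nonneg (CFC.sqrt_nonneg (a l x))).star_eq,
        CFC.sqrt_mul_sqrt_self _ (ha l x)]
    change 0 ≤ centralMk D (r l x)
    rw [hw, map_mul, map_star]
    exact star_mul_self_nonneg _
  have ho : ∀ l x y, x ≠ y → p l x * p l y = 0 := fun l x y hxy => by
    change centralMk D (r l x) * centralMk D (r l y) = 0
    rw [← map_mul, ← map_zero (centralMk D), centralMk_eq_iff]
    intro d hd
    change (a l x * a l y - 0) * toAInf d = 0
    rw [sub_zero]
    exact (haD d hd).orth l x y hxy
  have hg : ∀ l g x, centralAct α D hD g (p l x) = p l (g • x) := fun l g x => by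
    rw [centralAct_centralMk, centralMk_eq_iff]
    exact fun d hd => (haD d hd).equiv g l x
  have hu : IsUnitOf (∑ l, ∑ x, p l x) := fun y => by
    obtain ⟨y, rfl⟩ := centralMk_surjective D y
    have hs : (((∑ l, ∑ x, r l x : relComm D)) : AInf A) = ∑ l, ∑ x, a l x := by
      simp [r]
    simp only [p, ← map_sum, ← map_mul]
    constructor
    all_goals
      rw [centralMk_eq_iff]
      intro d hd
      rw [NonUnitalStarSubalgebra.coe_mul, hs, sub_mul, sub_eq_zero]
    · rw [mul_assoc, y.2 d hd, ← mul_assoc, (haD d hd).sum]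
    · rw [mul_assoc, (haD d hd).sum]
  -- A single tower sum is dominated by the sum over all towers, which is the unit.
  have hle : ∀ l, ‖∑ x, p l x‖ ≤ 1 := fun l => by
    refine le_trans (CStarAlgebra.norm_le_norm_of_nonneg_of_le
      (Finset.sum_nonneg fun x _ => hp l x) ?_) hu.norm_le_one
    exact Finset.single_le_sum (f := fun l => ∑ x, p l x)
      (fun l _ => Finset.sum_nonneg fun x _ => hp l x) (Finset.mem_univ l)
  refine ⟨fun l => cpOfNonneg (p l) (hp l), ⟨fun l =>
    cpOfNonneg_isContractiveOrderZero (hp l) (ho l) (hle l), fun l g f => ?_, ?_⟩,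
    fun hc k l hkl f f' => ?_⟩
  · simp only [cpOfNonneg_apply, map_sum, map_smul, hg, leftTranslate]
    refine Fintype.sum_equiv (MulAction.toPerm g⁻¹) _ _ fun x => ?_
    simp
  · simpa [cpOfNonneg_apply] using hu
  · simp only [cpOfNonneg_apply]
    refine Commute.sum_left _ _ _ fun x _ => Commute.sum_right _ _ _ fun y _ => ?_
    refine Commute.smul_left (Commute.smul_right ?_ _) _
    change centralMk D (r k x) * centralMk D (r l y) = centralMk D (r l y) * centralMk D (r k x)
    rw [← map_mul, ← map_mul, centralMk_eq_iff]
    exact fun d hd => (haD d hd).towers hc k x l y hkl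

/-- A separable C*-subalgebra `D` of `A` has a unit in `A_∞`. -/
theorem exists_unit_seq (D : NonUnitalStarSubalgebra ℂ A) (hDc : IsClosed (D : Set A))
    (hDs : IsSeparable (D : Set A)) :
    ∃ u : AInf A, ∀ d ∈ D, u * toAInf d = toAInf d ∧ toAInf d * u = toAInf d := by
  have := hDs.separableSpace
  -- The quasicentral unit for the trivial group, with D as an ideal in itself.
  obtain ⟨e, he0, -, he, -⟩ := exists_quasicentral_inf (1 : PUnit.{1} →* (D ≃⋆ₐ[ℂ] D))
    (NonUnitalStarAlgHom.id ℂ D) Function.injective_id (fun a j => ⟨a * j, rfl⟩)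
    (fun a j => ⟨j * a, rfl⟩) (T := toAInf '' Set.univ) (S := ∅)
    ((isSeparable_univ_iff.2 inferInstance).image continuous_toAInf) Set.countable_empty.isSeparable
  have hd : ∀ d ∈ D, toAInf d * infMap (NonUnitalStarSubalgebraClass.subtype D) e = toAInf d :=
    fun d hd => by
      have := congrArg (infMap (NonUnitalStarSubalgebraClass.subtype D))
        (he (toAInf ⟨d, hd⟩) ⟨_, trivial, rfl⟩)
      rwa [map_mul, infMap_toAInf] at this
  refine ⟨infMap (NonUnitalStarSubalgebraClass.subtype D) e, fun d hdD => ⟨?_, hd d hdD⟩⟩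
  have h := congrArg star (hd (star d) (star_mem hdD))
  rwa [star_mul, star_toAInf, star_star, ← map_star,
    (IsSelfAdjoint.of_nonneg he0).star_eq] at h

/-- The towers are positive lifts of the images of the point masses. Each relation modulo the
annihilator is a relation multiplied by the elements of D. -/
theorem HasFamilies.hasTowers [Countable G] {α : G →* (A ≃⋆ₐ[ℂ] A)} {H : Subgroup G}
    [H.FiniteIndex] {d : ℕ} {c : Prop} (h : HasFamilies α H d c) :
    HasTowers α H (Fin (d + 1)) c := by
  classical
  refine hasTowers_of_forall_subalgebra α H fun D hDc hDs hD => ?_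
  obtain ⟨φ, ⟨hφ, hg, hu⟩, hc⟩ := h D hDc hDs hD
  let δ : G ⧸ H → CosetFun H := fun x => Pi.single x 1
  have hδ : ∀ x, 0 ≤ δ x := fun x => Pi.single_nonneg.2 zero_le_one
  have hy : ∀ l x, ∃ y : relComm D, centralMk D (star y * y) = φ l (δ x) := fun l x => by
    obtain ⟨y, hy⟩ := CStarAlgebra.nonneg_iff_eq_star_mul_self.1 (map_nonneg (φ l) (hδ x))
    obtain ⟨y, rfl⟩ := centralMk_surjective D y
    exact ⟨y, by rw [hy, map_mul, map_star]⟩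
  choose y hy using hy
  let r : Fin (d + 1) → G ⧸ H → relComm D := fun l x => star (y l x) * y l x
  refine ⟨fun l x => r l x, fun l x => star_mul_self_nonneg (y l x : AInf A), fun z hz => ?_⟩
  refine ⟨fun l x => (r l x).2 z hz, fun l x x' hxx' => ?_, fun g l x => ?_, ?_,
    fun hcc l x k x' hlk => ?_⟩
  · have horth : Orth (δ x) (δ x') := by
      have : ∀ i, i ≠ x ∨ i ≠ x' := fun i => by
        by_contra! hi
        exact hxx' (hi.1.symm.trans hi.2)
      refine ⟨?_, ?_, ?_, ?_⟩ <;> ext i <;> rcases this i with hi | hi <;> simp [δ, hi]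
    have h1 := ((hφ l).orderZero _ _ horth).1
    rw [← hy, ← hy, ← map_mul, ← map_zero (centralMk D), centralMk_eq_iff] at h1
    have h2 := h1 z hz
    rwa [ZeroMemClass.coe_zero, sub_zero] at h2
  · have h1 := hg l g (δ x)
    have h2 : leftTranslate H g (δ x) = δ (g • x) := by
      ext i
      simp only [leftTranslate, δ, Pi.single_apply, inv_smul_eq_iff]
    rw [h2, ← hy, ← hy, centralAct_centralMk, eq_comm, centralMk_eq_iff] at h1
    exact h1 z hz
  -- That the sum is a unit is known only through its action on the quotient; testing it on the
  -- class of a unit u for D and multiplying by z gives the sum relation, as uz = z.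
  · obtain ⟨u, hu'⟩ := exists_unit_seq D hDc hDs
    let U : relComm D := ⟨u, fun d hd => (hu' d hd).1.trans (hu' d hd).2.symm⟩
    have h1 : ∑ l, φ l 1 = centralMk D (∑ l, ∑ x, r l x) := by
      rw [map_sum]
      refine Finset.sum_congr rfl fun l _ => ?_
      have h2 : (1 : CosetFun H) = ∑ x, δ x := by
        ext i
        simp [δ, Finset.sum_apply, Pi.single_apply]
      rw [h2, map_sum, map_sum]
      exact Finset.sum_congr rfl fun x _ => (hy l x).symm
    have h2 := (hu (centralMk D U)).1
    rw [h1, ← map_mul, centralMk_eq_iff] at h2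
    have h3 := h2 z hz
    have hs : ((∑ l, ∑ x, r l x : relComm D) : AInf A) = ∑ l, ∑ x, (r l x : AInf A) := by
      simp
    rw [NonUnitalStarSubalgebra.coe_mul, hs, sub_mul, sub_eq_zero, mul_assoc] at h3
    change _ * (u * toAInf z) = u * toAInf z at h3
    rwa [(hu' z hz).1] at h3
  · have h1 := hc hcc l k hlk (δ x) (δ x')
    have h2 : φ l (δ x) * φ k (δ x') = φ k (δ x') * φ l (δ x) := h1
    rw [← hy, ← hy, ← map_mul, ← map_mul, centralMk_eq_iff] at h2
    exact h2 z hz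

theorem HasTowers.reindex {α : G →* (A ≃⋆ₐ[ℂ] A)} {H : Subgroup G} [H.FiniteIndex] {c : Prop}
    {L L' : Type*} [Fintype L] [Fintype L'] (e : L ≃ L') (h : HasTowers α H L c) :
    HasTowers α H L' c := by
  intro Z hZ
  obtain ⟨a, ha, haZ⟩ := h Z hZ
  refine ⟨fun l => a (e.symm l), fun l x => ha _ x, fun z hz => ?_⟩
  obtain ⟨h1, h2, h3, h4, h5⟩ := haZ z hz
  refine ⟨fun l => h1 _, fun l => h2 _, fun g l => h3 g _, ?_, fun hc l x k y hlk =>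
    h5 hc _ x _ y (e.symm.injective.ne hlk)⟩
  rw [Equiv.sum_comp e.symm fun l => ∑ x, a l x]
  exact h4

end Families

/-! ### Rokhlin dimension of extensions -/

section Dimension

theorem HasFamilies.extension {G J A B : Type*} [Group G] [Countable G]
    [NonUnitalCStarAlgebra J] [NonUnitalCStarAlgebra A] [NonUnitalCStarAlgebra B]
    {α : G →* (J ≃⋆ₐ[ℂ] J)} {β : G →* (A ≃⋆ₐ[ℂ] A)} {γ : G →* (B ≃⋆ₐ[ℂ] B)}
    {ι : J →⋆ₙₐ[ℂ] A} {π : A →⋆ₙₐ[ℂ] B} (hext : IsEquivariantExtension α β γ ι π)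
    {H : Subgroup G} [H.FiniteIndex] {c : Prop} {m n : ℕ} (hα : HasFamilies α H m c)
    (hγ : HasFamilies γ H n c) : HasFamilies β H (m + n + 1) c := by
  refine HasTowers.hasFamilies (HasTowers.reindex ?_ (hα.hasTowers.extension hext hγ.hasTowers))
  -- Dimension d means d + 1 towers: (m + 1) + (n + 1) = (m + n + 1) + 1.
  exact finSumFinEquiv.trans (finCongr (by omega))

/-- Each infimum is either infinite, making the right side infinite, or attained. -/
theorem iInf_natCast_le_add {P Q R : ℕ → Prop} (h : ∀ m n, P m → Q n → R (m + n + 1)) :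
    (⨅ (d : ℕ) (_ : R d), (d : ℕ∞)) ≤
      (⨅ (d : ℕ) (_ : P d), (d : ℕ∞)) + (⨅ (d : ℕ) (_ : Q d), (d : ℕ∞)) + 1 := by
  classical
  have key : ∀ P : ℕ → Prop, (⨅ (d : ℕ) (_ : P d), (d : ℕ∞)) = ⊤ ∨
      ∃ d, P d ∧ (⨅ (d : ℕ) (_ : P d), (d : ℕ∞)) = d := fun P => by
    by_cases hP : ∃ d, P d
    · refine Or.inr ⟨Nat.find hP, Nat.find_spec hP, le_antisymm (iInf₂_le _ (Nat.find_spec hP)) ?_⟩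
      exact le_iInf₂ fun d hd => by exact_mod_cast Nat.find_min' hP hd
    · left
      push Not at hP
      simp [hP]
  obtain hP | ⟨m, hm, hP⟩ := key P
  · simp [hP]
  obtain hQ | ⟨n, hn, hQ⟩ := key Q
  · simp [hQ]
  rw [hP, hQ]
  refine (iInf₂_le _ (h m n hm hn)).trans ?_
  push_cast
  exact le_rfl

theorem iSup_le_add_of_forall {G : Type*} [Group G]
    {f g h : (H : Subgroup G) → H.FiniteIndex → ℕ∞}
    (hfgh : ∀ H hH, h H hH ≤ f H hH + g H hH + 1) :
    (⨆ (H : Subgroup G) (hH : H.FiniteIndex), h H hH) ≤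
      (⨆ (H : Subgroup G) (hH : H.FiniteIndex), f H hH) +
        (⨆ (H : Subgroup G) (hH : H.FiniteIndex), g H hH) + 1 := by
  refine iSup₂_le fun H hH => (hfgh H hH).trans ?_
  gcongr
  · exact le_iSup₂ (f := f) H hH
  · exact le_iSup₂ (f := g) H hH

end Dimension

end RokhlinDim

end

theorem mainTheorem6 {G : Type*} [Group G] [Group.FG G] [Group.ResiduallyFinite G]
    (hG : RokhlinDim.IsAmenable G) {J A B : Type*} [NonUnitalCStarAlgebra J]
    [NonUnitalCStarAlgebra A] [NonUnitalCStarAlgebra B]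
    (α : G →* (J ≃⋆ₐ[ℂ] J)) (β : G →* (A ≃⋆ₐ[ℂ] A)) (γ : G →* (B ≃⋆ₐ[ℂ] B))
    (ι : J →⋆ₙₐ[ℂ] A) (π : A →⋆ₙₐ[ℂ] B)
    (hext : RokhlinDim.IsEquivariantExtension α β γ ι π) :
    RokhlinDim.dimRok β ≤ RokhlinDim.dimRok α + RokhlinDim.dimRok γ + 1 ∧
      RokhlinDim.dimRokC β ≤ RokhlinDim.dimRokC α + RokhlinDim.dimRokC γ + 1 := by
  -- Countability keeps invariant subalgebras generated by separable sets separable and leaves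
  -- countably many conditions for the diagonal arguments.
  have := RokhlinDim.countable_of_group_fg G
  refine ⟨RokhlinDim.iSup_le_add_of_forall fun H hH => RokhlinDim.iInf_natCast_le_add fun m n hm hn =>
      ?_, RokhlinDim.iSup_le_add_of_forall fun H hH => RokhlinDim.iInf_natCast_le_add fun m n hm hn =>
      ?_⟩
  -- With `c` false no commutation between towers is required; with `c` true the same argument
  -- treats commuting towers.
  · have h := RokhlinDim.HasFamilies.extension (c := False) hext
      (fun D h1 h2 h3 => (hm D h1 h2 h3).imp fun φ hφ => ⟨hφ, False.elim⟩)
      (fun D h1 h2 h3 => (hn D h1 h2 h3).imp fun φ hφ => ⟨hφ, False.elim⟩)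
    exact fun D h1 h2 h3 => (h D h1 h2 h3).imp fun φ hφ => hφ.1
  · have h := RokhlinDim.HasFamilies.extension (c := True) hext
      (fun D h1 h2 h3 => (hm D h1 h2 h3).imp fun φ hφ => ⟨hφ.1, fun _ => hφ.2⟩)
      (fun D h1 h2 h3 => (hn D h1 h2 h3).imp fun φ hφ => ⟨hφ.1, fun _ => hφ.2⟩)
    exact fun D h1 h2 h3 => (h D h1 h2 h3).imp fun φ hφ => ⟨hφ.1, hφ.2 trivial⟩
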